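/- **Model.** Let $0<r_e<r_a<r_s$, put $h_a=r_a-r_e$ and $\bar\varphi=\arccos(r_e/r_a)+\arccos(r_e/r_s)$, and assume $\bar\varphi\le\pi/2$. Let $\lambda,\mu>0$ and $\alpha\ge 2$. Let $\Xi$ be a Poisson point process on $[0,\pi)\times[0,\pi)$ with density $\lambda\sin(\phi)/(2\pi)$; each point $(\theta,\phi)$ of it stands for the circular orbit of radius $r_s$ centered at the origin, with longitude $\theta$ and inclination $\phi$. Let the satellite process $\Psi$ be the Cox point process which, conditionally on $\Xi$, is a Poisson point process with intensity $\mu/(2\pi r_s)$ per unit of arc length on each of the orbits. The typical gateway is at $U=(0,0,r_e)$ and the typical aerial platform at $A=(0,0,r_a)$. The platform is associated with the nearest satellite in its extended spherical cap $\{x\in\mathbb R^3:\|x\|=r_s,\ \|x-A\|\le|\overline{AC}|\}$, where $|\overline{AC}|=\sqrt{r_s^2+r_a^2-2r_sr_a\cos\bar\varphi}$; let $D$ be the distance from $A$ to this satellite. The platform serves the gateway over the distance $h_a$. Let $p_s,p_a,g_s,g_a,g_g,N_o,B_s,B_a>0$ be the received powers at unit distance, the antenna gains, the noise density and the bandwidths,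 and let $\eta_s=p_sg_ag_s/(N_oB_s)$ and $\eta_g=p_ag_ag_g/(N_oB_a)$. The fading variables $H_A,H_G\ge 0$ of the two links have a common law with complementary distribution function $\bar F_H(x)=P(H\ge x)$, and $H_A$ is independent of $(\Xi,\Psi)$. The signal-to-noise ratios of the platform and of the gateway are $\mathrm{SNR}_A=\eta_sH_AD^{-\alpha}$ (and $\mathrm{SNR}_A=0$ if there is no satellite in the extended cap) and $\mathrm{SNR}_G=\eta_gH_Gh_a^{-\alpha}$. The achievable rate of a link is $\mathbb E[\log_2(1+\mathrm{SNR})]$, and the end-to-end throughput (network capacity) is the minimum of the achievable rates of the two links. **Theorem.** The end-to-end throughput equals $\min(R_A,R_G)$. Here $R_A=\mathbb E[\log_2(1+\mathrm{SNR}_A)]=\int_0^\infty P(\mathrm{SNR}_A>2^u-1)\,du$ is given by $$R_A=\int_0^\infty\!\int_{r_s-r_a}^{|\overline{AC}|}\!\int_0^{\zeta(z)}\frac{\lambda\mu z\,\bar F_H\!\left(\frac{(2^u-1)z^\alpha}{\eta_s}\right)e^{-\frac{\mu}{\pi}\beta_z(v)-\lambda\int_0^{\zeta(z)}\cos(w)\left(1-e^{-\frac{\mu}{\pi}\beta_z(w)}\right)dw}}{\pi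 r_sr_a\sqrt{1-\cos^2(\zeta(z))\sec^2(v)}}\,dv\,dz\,du,$$ where $\zeta(z)=\arccos\left(\frac{r_s^2+r_a^2-z^2}{2r_sr_a}\right)$ and $\beta_z(v)=\arcsin\sqrt{1-\cos^2(\zeta(z))\sec^2(v)}$, and $$R_G=\mathbb E[\log_2(1+\mathrm{SNR}_G)]=\int_0^\infty P(\mathrm{SNR}_G>2^u-1)\,du=\int_0^\infty\bar F_H\!\left(\frac{(2^u-1)h_a^\alpha}{\eta_g}\right)du,$$ as identities in $[0,\infty]$. In particular this holds for Nakagami fading with parameters $m,\Omega>0$, where $H$ has the density $\frac{x^{m-1}e^{-x/(m/\Omega)}}{\Gamma(m)(m/\Omega)^m}$ on $x\ge 0$; then $\bar F_H(x)=1-\gamma(m,\Omega x/m)/\Gamma(m)$ for $x\ge 0$, with $\gamma$ the lower incomplete gamma function, and $R_A$ and $R_G$ are finite. -/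

import Mathlib

open MeasureTheory ProbabilityTheory Set
open scoped ENNReal Real Nat

noncomputable section

namespace SatNet

/-- Three-dimensional Euclidean space, with the center of the Earth as origin. -/
abbrev E3 : Type := EuclideanSpace ℝ (Fin 3)

/-! ### Point processes -/

/-- The probability that a Poisson variable of mean `m` is equal to `k`
(a Poisson variable of infinite mean is infinite). -/
def poissonProb (m : ℝ≥0∞) (k : ℕ) : ℝ≥0∞ :=
  if m = ∞ then 0 else ENNReal.ofReal (Real.exp (-m.toReal) * m.toReal ^ k / (k ! : ℝ))

/-- A point process on `E`: a random measure, each realization of which is a finite or countable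
sum of unit point masses. -/
structure IsPointProcess {Ω E : Type*} [MeasurableSpace Ω] [MeasurableSpace E]
    (N : Ω → Measure E) : Prop where
  measurable : Measurable N
  counting : ∀ ω, ∃ (I : Set ℕ) (x : ℕ → E), N ω = Measure.sum fun i : I => Measure.dirac (x i)

/-- `N` is a Poisson point process with intensity measure `L`: the numbers of points in
pairwise disjoint sets are independent Poisson variables with means given by `L`. -/
structure IsPoissonProcess {Ω E : Type*} [MeasurableSpace Ω] [MeasurableSpace E]
    (P : Measure Ω) (N : Ω → Measure E) (L : Measure E) : Prop where
  isPointProcess : IsPointProcess N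
  prob_eq : ∀ (n : ℕ) (B : Fin n → Set E) (k : Fin n → ℕ),
    (∀ i, MeasurableSet (B i)) → Pairwise (fun i j => Disjoint (B i) (B j)) →
      P {ω | ∀ i, N ω (B i) = (k i : ℝ≥0∞)} = ∏ i, poissonProb (L (B i)) (k i)

/-- `N` is a Cox point process driven by the random element `X`: conditionally on (the
σ-algebra generated by) `X`, it is a Poisson point process with intensity measure `L X`. The
conditional probabilities are expressed by integrals over the events `X ⁻¹' G`. -/
structure IsCoxProcess {Ω E T : Type*} [MeasurableSpace Ω] [MeasurableSpace E] [MeasurableSpace T]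
    (P : Measure Ω) (N : Ω → Measure E) (X : Ω → T) (L : T → Measure E) : Prop where
  isPointProcess : IsPointProcess N
  condProb_eq : ∀ (n : ℕ) (B : Fin n → Set E) (k : Fin n → ℕ),
    (∀ i, MeasurableSet (B i)) → Pairwise (fun i j => Disjoint (B i) (B j)) →
      ∀ G : Set T, MeasurableSet G →
        P (X ⁻¹' G ∩ {ω | ∀ i, N ω (B i) = (k i : ℝ≥0∞)}) =
          ∫⁻ ω in X ⁻¹' G, ∏ i, poissonProb (L (X ω) (B i)) (k i) ∂P

/-! ### Orbits and satellites -/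

/-- Intensity measure of the orbit process: density `lam * sin φ / (2 π)` with respect to
Lebesgue measure on the rectangle `[0, π) × [0, π)` of pairs (longitude, inclination). -/
def orbitIntensity (lam : ℝ) : Measure (ℝ × ℝ) :=
  (volume.restrict (Ico 0 π ×ˢ Ico 0 π)).withDensity
    fun p => ENNReal.ofReal (lam * Real.sin p.2 / (2 * π))

/-- The point with argument angle `w` on the circular orbit of radius `rs`, longitude `p.1` and
inclination `p.2`. -/
def orbitPoint (rs : ℝ) (p : ℝ × ℝ) (w : ℝ) : E3 :=
  !₂[rs * (Real.cos w * Real.cos p.1 - Real.sin w * Real.cos p.2 * Real.sin p.1),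
     rs * (Real.cos w * Real.sin p.1 + Real.sin w * Real.cos p.2 * Real.cos p.1),
     rs * (Real.sin w * Real.sin p.2)]

/-- The sum, over the points `p` of the orbit configuration `ξ`, of the arc length measures
`rs dw` of the orbits with parameter `p`. -/
def orbitLength (rs : ℝ) (ξ : Measure (ℝ × ℝ)) : Measure E3 :=
  ENNReal.ofReal rs •
    (ξ.prod (volume.restrict (Ico 0 (2 * π)))).map fun q : (ℝ × ℝ) × ℝ => orbitPoint rs q.1 q.2

/-- Conditional intensity measure of the satellites: `mu / (2 π rs)` per unit of arc length on
each of the orbits. -/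
def satelliteIntensity (rs mu : ℝ) (ξ : Measure (ℝ × ℝ)) : Measure E3 :=
  ENNReal.ofReal (mu / (2 * π * rs)) • orbitLength rs ξ

/-! ### Geometry of the typical gateway and of the typical platform -/

/-- The point at distance `r` from the origin, above the North pole. -/
def polePoint (r : ℝ) : E3 := !₂[0, 0, r]

/-- The angle between the platform and the boundary of its extended spherical cap. -/
def phiBar (re ra rs : ℝ) : ℝ := Real.arccos (re / ra) + Real.arccos (re / rs)

/-- The distance from the platform to the boundary of its extended spherical cap. -/
def capDist (re ra rs : ℝ) : ℝ :=
  √(rs ^ 2 + ra ^ 2 - 2 * rs * ra * Real.cos (phiBar re ra rs))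

/-- The spherical cap of the points of the sphere of radius `rs` at distance at most `d`
from `x`. -/
def sphericalCap (rs : ℝ) (x : E3) (d : ℝ) : Set E3 := {y | ‖y‖ = rs ∧ ‖y - x‖ ≤ d}

/-- The extended spherical cap of the typical platform. -/
def extendedCap (re ra rs : ℝ) : Set E3 := sphericalCap rs (polePoint ra) (capDist re ra rs)

/-- The critical angle `ζ(z)`. -/
def zeta (ra rs z : ℝ) : ℝ := Real.arccos ((rs ^ 2 + ra ^ 2 - z ^ 2) / (2 * rs * ra))

/-- The distance from `x` to the nearest point of the configuration `ν` inside `S`, infinite if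
there is no such point. -/
def nearestDist (x : E3) (S : Set E3) (ν : Measure E3) : ℝ≥0∞ :=
  ⨅ y ∈ {y | y ∈ S ∧ ν {y} ≠ 0}, edist x y

/-! ### Signal-to-noise ratios and rates -/

/-- `p g / (No B)`: the signal-to-noise ratio at unit distance without fading, for received
power `p` at unit distance, antenna gains `g` and `g2`, noise density `No`, bandwidth `B`. -/
def linkSnr (p g g2 No B : ℝ) : ℝ := p * g * g2 / (No * B)

/-- Signal-to-noise ratio of a link of length `d` with fading `h`. It is `0` if there is no
transmitter, that is, if `d = ∞`. -/
def snr (α η h : ℝ) (d : ℝ≥0∞) : ℝ := if d = ∞ then 0 else η * h * d.toReal ^ (-α)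

/-- Signal-to-noise ratio of the typical platform, which is associated with the nearest
satellite in its extended spherical cap. -/
def snrPlatform {Ω : Type*} (re ra rs α η : ℝ) (Ψ : Ω → Measure E3) (H : Ω → ℝ) (ω : Ω) : ℝ :=
  snr α η (H ω) (nearestDist (polePoint ra) (extendedCap re ra rs) (Ψ ω))

/-- Signal-to-noise ratio of the typical gateway, which is served by the platform above it. -/
def snrGateway {Ω : Type*} (re ra α η : ℝ) (H : Ω → ℝ) (ω : Ω) : ℝ :=
  snr α η (H ω) (edist (polePoint ra) (polePoint re))

/-- The achievable rate `E[log₂(1 + SNR)]` of a link. -/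
def achievableRate {Ω : Type*} [MeasurableSpace Ω] (P : Measure Ω) (S : Ω → ℝ) : ℝ≥0∞ :=
  ∫⁻ ω, ENNReal.ofReal (Real.logb 2 (1 + S ω)) ∂P

/-- The end-to-end throughput: the minimum of the achievable rates of the two links. -/
def throughput {Ω : Type*} [MeasurableSpace Ω] (P : Measure Ω) (SA SG : Ω → ℝ) : ℝ≥0∞ :=
  min (achievableRate P SA) (achievableRate P SG)

/-- The integral `∫₀^∞ P(SNR > 2^u - 1) du`. -/
def tailIntegral {Ω : Type*} [MeasurableSpace Ω] (P : Measure Ω) (S : Ω → ℝ) : ℝ≥0∞ :=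
  ∫⁻ u in Ioi (0 : ℝ), P {ω | (2 : ℝ) ^ u - 1 < S ω}

/-! ### Fading -/

/-- Complementary cumulative distribution function `x ↦ P(H ≥ x)` of the law `κ`. -/
def ccdf (κ : Measure ℝ) (x : ℝ) : ℝ := (κ (Ici x)).toReal

/-- Lower incomplete gamma function. -/
def lowerGamma (s x : ℝ) : ℝ := ∫ t in (0 : ℝ)..x, t ^ (s - 1) * Real.exp (-t)

/-! ### The formulas -/

/-- `arcsin √(1 - cos² ζ(z) / cos² v)`. -/
def halfArc (ra rs z v : ℝ) : ℝ :=
  Real.arcsin (√(1 - Real.cos (zeta ra rs z) ^ 2 / Real.cos v ^ 2))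

/-- The integrand of the triple integral, at `(u, z, v)`; `F` is the complementary cumulative
distribution function of the fading. -/
def rateIntegrand (F : ℝ → ℝ) (lam mu ra rs α ηs u z v : ℝ) : ℝ :=
  lam * mu * z * F (((2 : ℝ) ^ u - 1) * z ^ α / ηs)
      * Real.exp (-(mu / π) * halfArc ra rs z v
          - lam * ∫ w in (0 : ℝ)..zeta ra rs z,
              Real.cos w * (1 - Real.exp (-(mu / π) * halfArc ra rs z w)))
    / (π * rs * ra * √(1 - Real.cos (zeta ra rs z) ^ 2 / Real.cos v ^ 2))

/-- The triple integral for the rate of the satellite-to-platform link. -/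
def rateA (F : ℝ → ℝ) (lam mu re ra rs α ηs : ℝ) : ℝ≥0∞ :=
  ∫⁻ u in Ioi (0 : ℝ), ∫⁻ z in Ioo (rs - ra) (capDist re ra rs), ∫⁻ v in Ioo 0 (zeta ra rs z),
    ENNReal.ofReal (rateIntegrand F lam mu ra rs α ηs u z v)

/-- The integral for the rate of the platform-to-gateway link. -/
def rateG (F : ℝ → ℝ) (ha α ηg : ℝ) : ℝ≥0∞ :=
  ∫⁻ u in Ioi (0 : ℝ), ENNReal.ofReal (F (((2 : ℝ) ^ u - 1) * ha ^ α / ηg))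

end SatNet

end

/-! By the layer-cake formula, `E[log₂(1 + SNR)]` is the integral over `u > 0` of `P(SNR > 2^u -
1)`, so everything reduces to the law of the distance `D` from the platform to the nearest
satellite.

The event `D ≥ a` says that the part of the cap nearer than `a` contains no satellite. Given the
orbits this has probability `exp (-(μ/2π) ∑ arc angles)`, and averaging over the orbits is an
evaluation of the Laplace functional of a Poisson process (`IsPoissonProcess.laplace`, `prob_void`).
An orbit of inclination `φ` has its highest point at angle `|v|` from the pole, `v = π/2 - φ`, and
meets the cap of radius `z` in an arc of angle `2 β_z(v)`. Hence `P(D ≥ z) = exp (-λ I(z))`, where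
`I` is `orbitHits` (`lintegral_orbitIntensity`, `prob_le_nearestDist`).

The density of `D` is therefore `λ I'(z) exp (-λ I(z))`, with an atom at `∞` when the cap is empty.
Since `I` is an integral with moving end point and its differentiated integrand is singular there,
the candidate `I'` is integrated back instead: Tonelli and the fundamental theorem of calculus for
each fixed `v` give `lintegral_hitsDensity`, and absolute continuity handles the exponential
(`lintegral_mul_exp_neg_primitive`, `map_nearestDist`).

Independence of fading and distance then yields the triple integral. The strict tail of the fading
may be replaced by `P(H ≥ x)`, because a law has only countably many atoms. Finiteness for Nakagami
fading follows from `log (1 + x) ≤ x` and the finite mean of the gamma law. -/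

section

open Filter Topology
open scoped NNReal

namespace SatNet

/-! ### The function `x ↦ exp (-x)` on `[0, ∞]` -/

/-- The function `x ↦ exp (-x)` on `[0, ∞]`, with `expNeg ∞ = 0`. -/
noncomputable def expNeg (x : ℝ≥0∞) : ℝ≥0∞ := EReal.exp (-(x : EReal))

@[simp] lemma expNeg_top : expNeg ∞ = 0 := by simp [expNeg]

@[simp] lemma expNeg_zero : expNeg 0 = 1 := by simp [expNeg]

lemma expNeg_ofReal {x : ℝ} (hx : 0 ≤ x) :
    expNeg (ENNReal.ofReal x) = ENNReal.ofReal (Real.exp (-x)) := by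
  rw [expNeg, EReal.coe_ennreal_ofReal, max_eq_left hx, ← EReal.coe_neg, EReal.exp_coe]

lemma expNeg_add (x y : ℝ≥0∞) : expNeg (x + y) = expNeg x * expNeg y := by
  rw [expNeg, EReal.coe_ennreal_add, EReal.neg_add (by simp) (by simp), sub_eq_add_neg,
    EReal.exp_add]
  rfl

lemma expNeg_sum {ι : Type*} (s : Finset ι) (f : ι → ℝ≥0∞) :
    expNeg (∑ i ∈ s, f i) = ∏ i ∈ s, expNeg (f i) := by
  classical
  induction s using Finset.induction_on with
  | empty => simp
  | insert i s hi ih => rw [Finset.sum_insert hi, Finset.prod_insert hi, expNeg_add, ih]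

lemma expNeg_le_one (x : ℝ≥0∞) : expNeg x ≤ 1 := by
  rw [expNeg, EReal.exp_le_one_iff, EReal.neg_le, neg_zero]
  exact EReal.coe_ennreal_nonneg x

lemma continuous_expNeg : Continuous expNeg :=
  ENNReal.continuous_exp.comp (continuous_neg.comp continuous_coe_ennreal_ereal)

lemma measurable_expNeg : Measurable expNeg := continuous_expNeg.measurable

/-- The convention for an infinite mean agrees with `expNeg ∞ = 0`, so void probabilities need no
finiteness assumption. -/
lemma poissonProb_zero (m : ℝ≥0∞) : poissonProb m 0 = expNeg m := by
  rcases eq_or_ne m ∞ with rfl | hm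
  · simp [poissonProb]
  · conv_rhs => rw [← ENNReal.ofReal_toReal hm, expNeg_ofReal ENNReal.toReal_nonneg]
    simp [poissonProb, hm]

lemma poissonProb_eq_poissonMeasure (m : ℝ≥0) (k : ℕ) :
    poissonProb m k = poissonMeasure m {k} := by
  simp [poissonProb, poissonMeasure_singleton]

/-! ### The Laplace functional of a Poisson process -/

/-- Laplace transform of the Poisson distribution. -/
lemma lintegral_expNeg_poissonMeasure (m c : ℝ≥0) :
    ∫⁻ k, expNeg (c * k) ∂(poissonMeasure m) = expNeg ((1 - expNeg c) * m) := by
  have hc : expNeg c = ENNReal.ofReal (Real.exp (-c)) := by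
    rw [← expNeg_ofReal c.coe_nonneg]; simp
  have hle : Real.exp (-c) ≤ 1 := by simp
  have h1 : (1 - expNeg c) * m = ENNReal.ofReal ((1 - Real.exp (-c)) * m) := by
    rw [hc, ENNReal.ofReal_mul (by linarith), ENNReal.ofReal_sub _ (Real.exp_pos _).le]; simp
  rw [h1, expNeg_ofReal (mul_nonneg (by linarith) m.coe_nonneg), lintegral_countable']
  have h2 : ∀ k : ℕ, expNeg (c * k) * poissonMeasure m {k} =
      ENNReal.ofReal (Real.exp (-m) * ((m * Real.exp (-c)) ^ k / (k ! : ℝ))) := by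
    intro k
    have : (c : ℝ≥0∞) * k = ENNReal.ofReal (c * k) := by
      rw [ENNReal.ofReal_mul c.coe_nonneg]; simp
    rw [this, expNeg_ofReal (by positivity), poissonMeasure_singleton,
      ← ENNReal.ofReal_mul (by positivity)]
    congr 1
    rw [mul_pow, ← Real.exp_nat_mul]
    ring_nf
  -- The exponential series at `m e^{-c}`, scaled by `e^{-m}`.
  have h3 := (NormedSpace.expSeries_div_hasSum_exp ((m : ℝ) * Real.exp (-c))).mul_left
    (Real.exp (-m))
  rw [← Real.exp_eq_exp_ℝ, ← Real.exp_add] at h3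
  simp_rw [h2]
  rw [← ENNReal.ofReal_tsum_of_nonneg (fun k => by positivity) h3.summable, h3.tsum_eq]
  congr 2
  ring

/-- The law of the numbers of points of a Poisson process in finitely many disjoint sets. -/
lemma IsPoissonProcess.lintegral_expNeg_sum {Ω E : Type*} [MeasurableSpace Ω] [MeasurableSpace E]
    {P : Measure Ω} [IsProbabilityMeasure P] {N : Ω → Measure E} {L : Measure E}
    [IsFiniteMeasure L] (h : IsPoissonProcess P N L) {n : ℕ} (B : Fin n → Set E)
    (hB : ∀ i, MeasurableSet (B i)) (hd : Pairwise fun i j => Disjoint (B i) (B j))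
    (c : Fin n → ℝ≥0) :
    ∫⁻ ω, expNeg (∑ i, c i * N ω (B i)) ∂P = expNeg (∑ i, (1 - expNeg (c i)) * L (B i)) := by
  let m : Fin n → ℝ≥0 := fun i => (L (B i)).toNNReal
  have hm : ∀ i, (m i : ℝ≥0∞) = L (B i) := fun i => ENNReal.coe_toNNReal (measure_ne_top _ _)
  let Q : Measure (Fin n → ℕ) := Measure.pi fun i => poissonMeasure (m i)
  let A : (Fin n → ℕ) → Set Ω := fun k => {ω | ∀ i, N ω (B i) = (k i : ℝ≥0∞)}
  have hNm : ∀ i, Measurable fun ω => N ω (B i) := fun i =>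
    (Measure.measurable_coe (hB i)).comp h.1.1
  have hA : ∀ k, MeasurableSet (A k) := fun k => by
    have : A k = ⋂ i, (fun ω => N ω (B i)) ⁻¹' {(k i : ℝ≥0∞)} := by ext; simp [A]
    rw [this]
    exact MeasurableSet.iInter fun i => hNm i (measurableSet_singleton _)
  have hAd : Pairwise fun k l => Disjoint (A k) (A l) := by
    intro k l hkl
    refine Set.disjoint_left.2 fun ω hk hl => hkl (funext fun i => ?_)
    have := (hk i).symm.trans (hl i)
    exact_mod_cast this
  have hP : ∀ k, P (A k) = Q {k} := fun k => by
    rw [h.prob_eq n B k hB hd, Measure.pi_singleton]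
    exact Finset.prod_congr rfl fun i _ => by rw [← hm, poissonProb_eq_poissonMeasure]
  -- `Q` has total mass one on a countable space, so almost surely all the counts are finite and one
  -- of the events `A k` occurs.
  have hU : P (⋃ k, A k) = 1 := by
    rw [measure_iUnion hAd hA]
    simp_rw [hP]
    have := (lintegral_countable' (μ := Q) (fun _ => 1)).symm
    simpa [Q] using this
  have hae : (⋃ k, A k : Set Ω) =ᵐ[P] univ := by
    rw [ae_eq_univ, prob_compl_eq_zero_iff (MeasurableSet.iUnion hA), hU]
  calc ∫⁻ ω, expNeg (∑ i, c i * N ω (B i)) ∂P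
      = ∫⁻ ω in ⋃ k, A k, expNeg (∑ i, c i * N ω (B i)) ∂P := by
        rw [setLIntegral_congr hae, setLIntegral_univ]
    _ = ∑' k, ∫⁻ ω in A k, expNeg (∑ i, c i * N ω (B i)) ∂P :=
        lintegral_iUnion hA hAd _
    _ = ∑' k : Fin n → ℕ, expNeg (∑ i, c i * (k i : ℝ≥0∞)) * Q {k} := by
        congr with k
        rw [← hP, ← setLIntegral_const]
        refine setLIntegral_congr_fun (hA k) fun ω hω => ?_
        rw [Finset.sum_congr rfl fun i _ => by rw [hω i]]
    _ = ∫⁻ k, ∏ i, expNeg (c i * (k i : ℝ≥0∞)) ∂Q := by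
        rw [lintegral_countable']
        exact tsum_congr fun k => by rw [expNeg_sum]
    _ = ∏ i, ∫⁻ k, expNeg (c i * (k i : ℝ≥0∞)) ∂Q := by
        refine lintegral_prod_eq_prod_lintegral_of_indepFun Finset.univ
          (fun i (k : Fin n → ℕ) => expNeg (c i * (k i : ℝ≥0∞))) ?_ (fun i => ?_)
        · exact iIndepFun_pi (X := fun i (k : ℕ) => expNeg (c i * (k : ℝ≥0∞)))
            fun i => (measurable_from_top).aemeasurable
        · exact (measurable_from_top (f := fun k : ℕ => expNeg (c i * (k : ℝ≥0∞)))).comp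
            (measurable_pi_apply i)
    _ = ∏ i, ∫⁻ k : ℕ, expNeg (c i * k) ∂(poissonMeasure (m i)) := by
        refine Finset.prod_congr rfl fun i _ => ?_
        exact (measurePreserving_eval (fun i => poissonMeasure (m i)) i).lintegral_comp
          (f := fun k : ℕ => expNeg (c i * (k : ℝ≥0∞))) measurable_from_top
    _ = expNeg (∑ i, (1 - expNeg (c i)) * L (B i)) := by
        rw [expNeg_sum]
        exact Finset.prod_congr rfl fun i _ => by rw [lintegral_expNeg_poissonMeasure, hm]

/-- The level sets of a simple function are disjoint, and its integral against `N ω` is a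
combination of the counts in them. -/
lemma IsPoissonProcess.laplace_simpleFunc {Ω E : Type*} [MeasurableSpace Ω] [MeasurableSpace E]
    {P : Measure Ω} [IsProbabilityMeasure P] {N : Ω → Measure E} {L : Measure E}
    [IsFiniteMeasure L] (h : IsPoissonProcess P N L) (f : SimpleFunc E ℝ≥0∞)
    (hf : ∀ x, f x ≠ ∞) :
    ∫⁻ ω, expNeg (∫⁻ x, f x ∂(N ω)) ∂P = expNeg (∫⁻ x, (1 - expNeg (f x)) ∂L) := by
  let e := f.range.equivFin.symm
  let c : Fin f.range.card → ℝ≥0 := fun i => (e i : ℝ≥0∞).toNNReal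
  have hc : ∀ i, (c i : ℝ≥0∞) = e i := fun i => by
    obtain ⟨x, hx⟩ := SimpleFunc.mem_range.1 (e i).2
    exact ENNReal.coe_toNNReal (hx ▸ hf x)
  have key := h.lintegral_expNeg_sum (fun i => f ⁻¹' {(e i : ℝ≥0∞)})
    (fun i => f.measurableSet_preimage _) (fun i j hij => by
      refine Disjoint.preimage _ (Set.disjoint_singleton.2 fun hh => hij ?_)
      exact e.injective (Subtype.ext hh)) c
  have hsum : ∀ (F : ℝ≥0∞ → ℝ≥0∞), ∑ i, F (e i) = ∑ x ∈ f.range, F x := fun F => by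
    rw [e.sum_comp (fun x : f.range => F x), Finset.sum_coe_sort f.range F]
  simp_rw [hc] at key
  have h1 : ∀ ω, ∫⁻ x, f x ∂(N ω) = ∑ i, (e i : ℝ≥0∞) * N ω (f ⁻¹' {(e i : ℝ≥0∞)}) := fun ω => by
    rw [hsum fun x => x * N ω (f ⁻¹' {x}), SimpleFunc.lintegral_eq_lintegral]; rfl
  have h2 : ∫⁻ x, (1 - expNeg (f x)) ∂L =
      ∑ i, (1 - expNeg (e i)) * L (f ⁻¹' {(e i : ℝ≥0∞)}) := by
    rw [hsum fun x => (1 - expNeg x) * L (f ⁻¹' {x}), ← SimpleFunc.map_lintegral,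
      ← SimpleFunc.lintegral_eq_lintegral]; rfl
  simp_rw [h1, h2, key]

/-- The Laplace functional of a Poisson process. -/
theorem IsPoissonProcess.laplace {Ω E : Type*} [MeasurableSpace Ω] [MeasurableSpace E]
    {P : Measure Ω} [IsProbabilityMeasure P] {N : Ω → Measure E} {L : Measure E}
    [IsFiniteMeasure L] (h : IsPoissonProcess P N L) {g : E → ℝ≥0∞} (hg : Measurable g) :
    ∫⁻ ω, expNeg (∫⁻ x, g x ∂(N ω)) ∂P = expNeg (∫⁻ x, (1 - expNeg (g x)) ∂L) := by
  let f := SimpleFunc.eapprox g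
  have hmono : ∀ x, Monotone fun n => f n x := fun x m n hmn => SimpleFunc.monotone_eapprox g hmn x
  have hlim : ∀ x, Tendsto (fun n => f n x) atTop (𝓝 (g x)) := fun x => by
    rw [← SimpleFunc.iSup_eapprox_apply hg x]
    exact tendsto_atTop_iSup (hmono x)
  have hint : ∀ ω, Tendsto (fun n => ∫⁻ x, f n x ∂(N ω)) atTop (𝓝 (∫⁻ x, g x ∂(N ω))) := fun ω =>
    lintegral_tendsto_of_tendsto_of_monotone (fun n => (f n).measurable.aemeasurable)
      (ae_of_all _ hmono) (ae_of_all _ hlim)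
  have hleft : Tendsto (fun n => ∫⁻ ω, expNeg (∫⁻ x, f n x ∂(N ω)) ∂P) atTop
      (𝓝 (∫⁻ ω, expNeg (∫⁻ x, g x ∂(N ω)) ∂P)) := by
    refine tendsto_lintegral_of_dominated_convergence (fun _ => 1) (fun n => ?_)
      (fun n => ae_of_all _ fun ω => expNeg_le_one _) (by simp) (ae_of_all _ fun ω => ?_)
    · exact measurable_expNeg.comp
        ((Measure.measurable_lintegral (f n).measurable).comp h.1.1)
    · exact (continuous_expNeg.tendsto _).comp (hint ω)
  have hright : Tendsto (fun n => expNeg (∫⁻ x, (1 - expNeg (f n x)) ∂L)) atTop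
      (𝓝 (expNeg (∫⁻ x, (1 - expNeg (g x)) ∂L))) := by
    refine (continuous_expNeg.tendsto _).comp ?_
    -- Finiteness of `L` makes the constant `1` an admissible bound.
    refine tendsto_lintegral_of_dominated_convergence (fun _ => 1) (fun n => ?_)
      (fun n => ae_of_all _ fun ω => tsub_le_self) (by simp) (ae_of_all _ fun x => ?_)
    · exact measurable_const.sub (measurable_expNeg.comp (f n).measurable)
    · exact ENNReal.Tendsto.sub tendsto_const_nhds ((continuous_expNeg.tendsto _).comp (hlim x))
        (Or.inl ENNReal.one_ne_top)
  refine tendsto_nhds_unique hleft (hright.congr fun n => ?_)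
  exact (h.laplace_simpleFunc (f n) fun x => (SimpleFunc.eapprox_lt_top g n x).ne).symm

/-! ### Void probabilities of the satellite process -/

instance (lam : ℝ) : IsFiniteMeasure (orbitIntensity lam) := by
  refine isFiniteMeasure_withDensity (ne_of_lt ?_)
  refine (lintegral_mono (g := fun _ => ENNReal.ofReal (|lam| / (2 * π))) fun p => ?_).trans_lt ?_
  · refine ENNReal.ofReal_le_ofReal ?_
    gcongr
    refine (le_abs_self _).trans ?_
    rw [abs_mul]
    exact mul_le_of_le_one_right (abs_nonneg _) (Real.abs_sin_le_one _)
  · rw [setLIntegral_const]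
    refine ENNReal.mul_lt_top ENNReal.ofReal_lt_top ?_
    rw [Measure.volume_eq_prod, Measure.prod_prod]
    exact ENNReal.mul_lt_top (by simp) (by simp)

lemma measurable_orbitPoint (rs : ℝ) :
    Measurable fun q : (ℝ × ℝ) × ℝ => orbitPoint rs q.1 q.2 := by
  refine Continuous.measurable ?_
  refine (PiLp.continuous_toLp 2 _).comp (continuous_pi fun i => ?_)
  fin_cases i <;> simp <;> fun_prop

/-- The set of the argument angles of the points in `B` of an orbit. -/
def arc (rs : ℝ) (B : Set E3) (p : ℝ × ℝ) : Set ℝ :=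
  {w | w ∈ Ico 0 (2 * π) ∧ orbitPoint rs p w ∈ B}

lemma measurable_volume_arc (rs : ℝ) {B : Set E3} (hB : MeasurableSet B) :
    Measurable fun p => volume (arc rs B p) := by
  have : MeasurableSet {q : (ℝ × ℝ) × ℝ | q.2 ∈ Ico 0 (2 * π) ∧ orbitPoint rs q.1 q.2 ∈ B} :=
    (measurable_snd measurableSet_Ico).inter (measurable_orbitPoint rs hB)
  exact measurable_measure_prodMk_left this

/-- The radius cancels between arc length `rs dw` and intensity `mu / (2 π rs)`. The integral is
sliced along orbits, which requires nothing of `ξ`. -/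
lemma satelliteIntensity_apply {rs mu : ℝ} (hrs : 0 < rs) (hmu : 0 ≤ mu) (ξ : Measure (ℝ × ℝ))
    {B : Set E3} (hB : MeasurableSet B) :
    satelliteIntensity rs mu ξ B =
      ∫⁻ p, ENNReal.ofReal (mu / (2 * π)) * volume (arc rs B p) ∂ξ := by
  have hm := measurable_orbitPoint rs
  rw [satelliteIntensity, orbitLength, Measure.smul_apply, Measure.smul_apply,
    Measure.map_apply hm hB, Measure.prod_apply (hm hB),
    lintegral_const_mul _ (measurable_volume_arc rs hB), smul_eq_mul, smul_eq_mul, ← mul_assoc,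
    ← ENNReal.ofReal_mul (by positivity)]
  congr 2
  · field_simp
  · funext p
    have : Measurable (orbitPoint rs p) := Measurable.of_uncurry_left (f := orbitPoint rs) hm
    change volume.restrict (Ico 0 (2 * π)) (orbitPoint rs p ⁻¹' B) = _
    rw [Measure.restrict_apply (this hB), inter_comm, arc, ofPred_and]
    rfl

/-- The probability that there is no satellite in `B`. -/
theorem prob_void {Ω : Type*} [MeasurableSpace Ω] {P : Measure Ω} [IsProbabilityMeasure P]
    {rs lam mu : ℝ} (hrs : 0 < rs) (hmu : 0 ≤ mu)
    {Ξ : Ω → Measure (ℝ × ℝ)} {Ψ : Ω → Measure E3}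
    (hΞ : IsPoissonProcess P Ξ (orbitIntensity lam))
    (hΨ : IsCoxProcess P Ψ Ξ (satelliteIntensity rs mu)) {B : Set E3} (hB : MeasurableSet B) :
    P {ω | Ψ ω B = 0} =
      expNeg (∫⁻ p, (1 - expNeg (ENNReal.ofReal (mu / (2 * π)) * volume (arc rs B p)))
        ∂(orbitIntensity lam)) := by
  -- One set, count zero, and no restriction on the orbits.
  have h := hΨ.condProb_eq 1 (fun _ => B) (fun _ => 0) (fun _ => hB)
    (fun i j hij => absurd (Subsingleton.elim i j) hij) univ MeasurableSet.univ
  simp only [preimage_univ, univ_inter, forall_const, Nat.cast_zero, Finset.univ_unique,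
    Finset.prod_const, Finset.card_singleton, pow_one, poissonProb_zero,
    Measure.restrict_univ] at h
  rw [h, ← hΞ.laplace ((measurable_volume_arc rs hB).const_mul _)]
  simp_rw [satelliteIntensity_apply hrs hmu _ hB]

/-- A sum of point masses charges a measurable set only if one of its atoms lies there. The strict
inequality avoids asking whether the infimum is attained. -/
lemma nearestDist_lt_iff {x : E3} {S : Set E3} {ν : Measure E3}
    (hν : ∃ (I : Set ℕ) (y : ℕ → E3), ν = Measure.sum fun i : I => Measure.dirac (y i))
    (hS : MeasurableSet S) (a : ℝ≥0∞) :
    nearestDist x S ν < a ↔ ν {y | y ∈ S ∧ edist x y < a} ≠ 0 := by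
  have hm : MeasurableSet {y | y ∈ S ∧ edist x y < a} :=
    hS.inter (measurableSet_lt (measurable_const.edist measurable_id) measurable_const)
  simp only [nearestDist, iInf_lt_iff]
  constructor
  · intro ⟨y, ⟨hyS, hy⟩, hlt⟩ h0
    exact hy (measure_mono_null (t := {y | y ∈ S ∧ edist x y < a})
      (singleton_subset_iff.2 ⟨hyS, hlt⟩) h0)
  · obtain ⟨I, y, rfl⟩ := hν
    intro h
    rw [Measure.sum_apply _ hm, Ne, ENNReal.tsum_eq_zero, not_forall] at h
    obtain ⟨i, hi⟩ := h
    rw [Measure.dirac_apply' _ hm, indicator_apply_eq_zero, Classical.not_imp] at hi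
    refine ⟨y i, ⟨hi.1.1, ?_⟩, hi.1.2⟩
    rw [Measure.sum_apply _ (measurableSet_singleton _), Ne, ENNReal.tsum_eq_zero, not_forall]
    exact ⟨i, by simp⟩

lemma measurableSet_sphericalCap (rs : ℝ) (x : E3) (d : ℝ) :
    MeasurableSet (sphericalCap rs x d) :=
  (measurableSet_eq_fun measurable_norm measurable_const).inter
    (measurableSet_le (measurable_id.sub_const x).norm measurable_const)

/-- The σ-algebra on `Ω` is left arbitrary so that it can later be the one generated by `Ψ`. -/
lemma measurable_nearestDist {Ω : Type*} [MeasurableSpace Ω] {Ψ : Ω → Measure E3}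
    (hΨ : Measurable Ψ)
    (hc : ∀ ω, ∃ (I : Set ℕ) (y : ℕ → E3), Ψ ω = Measure.sum fun i : I => Measure.dirac (y i))
    (x : E3) {S : Set E3} (hS : MeasurableSet S) :
    Measurable fun ω => nearestDist x S (Ψ ω) := by
  refine measurable_of_Iio fun a => ?_
  have hm : MeasurableSet {y | y ∈ S ∧ edist x y < a} :=
    hS.inter (measurableSet_lt (measurable_const.edist measurable_id) measurable_const)
  have : (fun ω => nearestDist x S (Ψ ω)) ⁻¹' Iio a =
      (fun ω => Ψ ω {y | y ∈ S ∧ edist x y < a}) ⁻¹' {0}ᶜ := by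
    ext ω
    exact nearestDist_lt_iff (hc ω) hS a
  rw [this]
  exact ((Measure.measurable_coe hm).comp hΨ) (measurableSet_singleton 0).compl

/-! ### Geometry of the spherical caps -/

/-- The cosine of the angle, seen from the origin, between the pole and the points at distance `z`
from the platform. -/
noncomputable def capCos (ra rs z : ℝ) : ℝ := (rs ^ 2 + ra ^ 2 - z ^ 2) / (2 * rs * ra)

lemma norm_orbitPoint {rs : ℝ} (hrs : 0 ≤ rs) (p : ℝ × ℝ) (w : ℝ) : ‖orbitPoint rs p w‖ = rs := by
  rw [EuclideanSpace.norm_eq, Real.sqrt_eq_iff_mul_self_eq (by positivity) hrs,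
    Fin.sum_univ_three]
  simp only [orbitPoint, Real.norm_eq_abs, sq_abs]
  simp
  have h1 := Real.sin_sq_add_cos_sq w
  have h2 := Real.sin_sq_add_cos_sq p.1
  have h3 := Real.sin_sq_add_cos_sq p.2
  have e1 : Real.sin w ^ 2 = 1 - Real.cos w ^ 2 := by linarith
  have e2 : Real.sin p.1 ^ 2 = 1 - Real.cos p.1 ^ 2 := by linarith
  have e3 : Real.sin p.2 ^ 2 = 1 - Real.cos p.2 ^ 2 := by linarith
  ring_nf
  rw [e1, e2, e3]
  ring

lemma norm_sub_polePoint_sq (ra : ℝ) (y : E3) :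
    ‖y - polePoint ra‖ ^ 2 = ‖y‖ ^ 2 + ra ^ 2 - 2 * ra * y 2 := by
  rw [EuclideanSpace.norm_sq_eq, EuclideanSpace.norm_sq_eq, Fin.sum_univ_three, Fin.sum_univ_three]
  simp [polePoint]
  ring

lemma orbitPoint_two (rs : ℝ) (p : ℝ × ℝ) (w : ℝ) :
    orbitPoint rs p w 2 = rs * (Real.sin w * Real.sin p.2) := rfl

/-- By the law of cosines, the distance from a point of the sphere to the platform depends only on
the height of the point. -/
lemma norm_orbitPoint_sub_le_iff {ra rs z : ℝ} (hra : 0 < ra) (hrs : 0 < rs) (hz : 0 ≤ z)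
    (p : ℝ × ℝ) (w : ℝ) :
    ‖orbitPoint rs p w - polePoint ra‖ ≤ z ↔ capCos ra rs z ≤ Real.sin w * Real.sin p.2 := by
  rw [← sq_le_sq₀ (norm_nonneg _) hz, norm_sub_polePoint_sq, norm_orbitPoint hrs.le,
    orbitPoint_two, capCos, div_le_iff₀ (by positivity)]
  constructor <;> intro h <;> linarith

lemma norm_orbitPoint_sub_lt_iff {ra rs z : ℝ} (hra : 0 < ra) (hrs : 0 < rs) (hz : 0 ≤ z)
    (p : ℝ × ℝ) (w : ℝ) :
    ‖orbitPoint rs p w - polePoint ra‖ < z ↔ capCos ra rs z < Real.sin w * Real.sin p.2 := by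
  rw [← sq_lt_sq₀ (norm_nonneg _) hz, norm_sub_polePoint_sq, norm_orbitPoint hrs.le,
    orbitPoint_two, capCos, div_lt_iff₀ (by positivity)]
  constructor <;> intro h <;> linarith

/-- The length of the part of an orbit of inclination with sine `s` that lies above a
given latitude, whether or not the boundary points are included. -/
lemma volume_arc_of_sin {s C : ℝ} (hs : 0 < s) (hC : 0 ≤ C) {T : Set ℝ}
    (h1 : ∀ w ∈ Ico 0 (2 * π), C < Real.sin w * s → w ∈ T)
    (h2 : ∀ w ∈ T, w ∈ Ico 0 (2 * π) ∧ C ≤ Real.sin w * s) :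
    volume T = ENNReal.ofReal (2 * Real.arccos (C / s)) := by
  have hpi := Real.pi_pos
  have hx : 0 ≤ C / s := by positivity
  rcases le_or_gt (C / s) 1 with hx1 | hx1
  · set a := Real.arcsin (C / s) with ha
    have hsin : Real.sin a = C / s := Real.sin_arcsin (by linarith) hx1
    have ha0 : 0 ≤ a := Real.arcsin_nonneg.2 hx
    have ha1 : a ≤ π / 2 := Real.arcsin_le_pi_div_two _
    have hlen : ENNReal.ofReal (2 * Real.arccos (C / s)) = ENNReal.ofReal (π - a - a) := by
      rw [Real.arccos, ← ha]; ring_nf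
    rw [hlen]
    -- `T` lies between `Ioo a (π - a)` and `Icc a (π - a)`.
    refine le_antisymm ?_ ?_
    · rw [← Real.volume_Icc]
      refine measure_mono fun w hw => ?_
      obtain ⟨hw, hCw⟩ := h2 w hw
      have hsw : Real.sin a ≤ Real.sin w := by rw [hsin]; exact (div_le_iff₀ hs).2 hCw
      have key : ∀ t, -(π / 2) ≤ t → Real.sin a ≤ Real.sin t → a ≤ t := fun t ht h => by
        by_contra! hlt
        exact absurd h (not_le.2 (Real.sin_lt_sin_of_lt_of_le_pi_div_two ht ha1 hlt))
      refine ⟨key w (by linarith [hw.1]) hsw, ?_⟩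
      have hwpi : w ≤ π := by
        by_contra! hlt
        have : Real.sin (w - π) > 0 :=
          Real.sin_pos_of_pos_of_lt_pi (by linarith) (by linarith [hw.2])
        rw [Real.sin_sub_pi] at this
        have : 0 ≤ Real.sin a := by rw [hsin]; exact hx
        linarith
      have := key (π - w) (by linarith) (by rwa [Real.sin_pi_sub])
      linarith
    · rw [← Real.volume_Ioo]
      refine measure_mono fun w hw => h1 w ⟨by linarith [hw.1], by linarith [hw.2]⟩ ?_
      rw [← div_lt_iff₀ hs, ← hsin]
      rcases le_or_gt w (π / 2) with h | h
      · exact Real.sin_lt_sin_of_lt_of_le_pi_div_two (by linarith) h hw.1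
      · rw [← Real.sin_pi_sub w]
        exact Real.sin_lt_sin_of_lt_of_le_pi_div_two (by linarith) (by linarith)
          (by linarith [hw.2])
  -- The orbit stays below the given latitude, and `Real.arccos` is `0` beyond `1`.
  · have hT : T = ∅ := by
      refine eq_empty_of_forall_notMem fun w hw => ?_
      have := (h2 w hw).2
      have h3 := Real.sin_le_one w
      rw [one_lt_div hs] at hx1
      nlinarith
    rw [hT, Real.arccos_of_one_le hx1.le]
    simp

/-- The minimum covers distances below `rs - ra`, where `capCos` exceeds `1` and `Real.arccos`
truncates. -/
lemma cos_zeta {ra rs z : ℝ} (h : 0 ≤ capCos ra rs z) :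
    Real.cos (zeta ra rs z) = min (capCos ra rs z) 1 := by
  rw [zeta, ← capCos]
  rcases le_total (capCos ra rs z) 1 with h1 | h1
  · rw [Real.cos_arccos (by linarith) h1, min_eq_left h1]
  · rw [Real.arccos_of_one_le h1, min_eq_right h1, Real.cos_zero]

/-- The form used for arc lengths and for differentiation in `z`. For orbits that miss the cap, the
truncations of square root and arccosine both give `0`. -/
lemma halfArc_eq_arccos {ra rs z v : ℝ} (h : 0 ≤ capCos ra rs z) (hv : 0 < Real.cos v) :
    halfArc ra rs z v = Real.arccos (capCos ra rs z / Real.cos v) := by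
  rw [halfArc, cos_zeta h]
  rcases le_total (capCos ra rs z) 1 with h1 | h1
  · rw [min_eq_left h1, Real.arccos_eq_arcsin (by positivity), div_pow]
  · have h2 : Real.cos v ^ 2 ≤ 1 := Real.cos_sq_le_one v
    rw [min_eq_right h1, Real.arccos_of_one_le, Real.sqrt_eq_zero_of_nonpos, Real.arcsin_zero]
    · have : 1 ≤ 1 ^ 2 / Real.cos v ^ 2 := by rw [one_le_div (by positivity)]; simpa using h2
      linarith
    · rw [one_le_div hv]; exact (Real.cos_le_one v).trans h1

lemma halfArc_nonneg (ra rs z v : ℝ) : 0 ≤ halfArc ra rs z v :=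
  Real.arcsin_nonneg.2 (Real.sqrt_nonneg _)

lemma halfArc_neg (ra rs z v : ℝ) : halfArc ra rs z (-v) = halfArc ra rs z v := by
  simp [halfArc]

lemma measurable_halfArc (ra rs z : ℝ) : Measurable fun v => halfArc ra rs z v := by
  unfold halfArc
  exact Real.continuous_arcsin.measurable.comp (by fun_prop)

/-- The mean number, divided by `lam`, of orbits with a satellite at distance at most `z` from the
platform. -/
noncomputable def orbitHits (mu ra rs z : ℝ) : ℝ :=
  ∫ w in (0 : ℝ)..zeta ra rs z, Real.cos w * (1 - Real.exp (-(mu / π) * halfArc ra rs z w))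

lemma exp_neg_mul_le_one {c x : ℝ} (hc : 0 ≤ c) (hx : 0 ≤ x) : Real.exp (-c * x) ≤ 1 :=
  Real.exp_le_one_iff.2 (by nlinarith [mul_nonneg hc hx])

lemma intervalIntegrable_cos_mul_one_sub_exp {mu : ℝ} (hmu : 0 ≤ mu) (ra rs z a b : ℝ) :
    IntervalIntegrable
      (fun v => Real.cos v * (1 - Real.exp (-(mu / π) * halfArc ra rs z v))) volume a b := by
  have := measurable_halfArc ra rs z
  refine (intervalIntegrable_const (c := (1 : ℝ))).mono_fun ?_ (ae_of_all _ fun v => ?_)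
  · exact (by fun_prop : Measurable _).aestronglyMeasurable
  · have h1 := exp_neg_mul_le_one (c := mu / π) (by positivity) (halfArc_nonneg ra rs z v)
    have h2 := Real.exp_pos (-(mu / π) * halfArc ra rs z v)
    simp only [norm_mul, norm_one]
    exact mul_le_one₀ (Real.abs_cos_le_one v) (norm_nonneg _)
      (by rw [Real.norm_eq_abs, abs_le]; constructor <;> linarith)

lemma zeta_nonneg (ra rs z : ℝ) : 0 ≤ zeta ra rs z := Real.arccos_nonneg _

lemma zeta_le_pi_div_two {ra rs z : ℝ} (h : 0 ≤ capCos ra rs z) : zeta ra rs z ≤ π / 2 :=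
  Real.arccos_le_pi_div_two.2 h

lemma halfArc_of_zeta_le {ra rs z v : ℝ} (h : 0 ≤ capCos ra rs z) (h1 : zeta ra rs z ≤ v)
    (h2 : v < π / 2) : halfArc ra rs z v = 0 := by
  have hz := zeta_nonneg ra rs z
  have hv : 0 < Real.cos v := Real.cos_pos_of_mem_Ioo ⟨by linarith, h2⟩
  have hcos := Real.cos_le_cos_of_nonneg_of_le_pi hz (by linarith) h1
  rw [cos_zeta h] at hcos
  rw [halfArc_eq_arccos h hv, Real.arccos_of_one_le]
  rw [one_le_div hv]
  exact hcos.trans (min_le_left _ _)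

/-- Substitute `v = π/2 - x`: the integrand becomes even in `v` and vanishes between `ζ(z)` and
`π/2`, since those orbits have no arc of positive length in the cap. -/
lemma integral_sin_mul_eq_orbitHits {mu ra rs z : ℝ} (hmu : 0 ≤ mu) (h : 0 ≤ capCos ra rs z) :
    ∫ x in (0 : ℝ)..π, Real.sin x * (1 - Real.exp (-(mu / π) * halfArc ra rs z (π / 2 - x))) =
      2 * orbitHits mu ra rs z := by
  set f : ℝ → ℝ := fun v => Real.cos v * (1 - Real.exp (-(mu / π) * halfArc ra rs z v)) with hf
  have hint := intervalIntegrable_cos_mul_one_sub_exp hmu ra rs z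
  have hz := zeta_nonneg ra rs z
  have hz2 := zeta_le_pi_div_two h
  have h1 : ∫ x in (0 : ℝ)..π,
      Real.sin x * (1 - Real.exp (-(mu / π) * halfArc ra rs z (π / 2 - x))) =
      ∫ x in (0 : ℝ)..π, f (π / 2 - x) := by
    simp [hf, Real.cos_pi_div_two_sub]
  have h2 : ∫ v in -(π / 2)..0, f v = ∫ v in (0 : ℝ)..π / 2, f v := by
    have := intervalIntegral.integral_comp_neg f (a := 0) (b := π / 2)
    rw [neg_zero] at this
    rw [← this]
    simp [hf, halfArc_neg]
  have h3 : ∫ v in zeta ra rs z..π / 2, f v = 0 := by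
    refine intervalIntegral.integral_zero_ae (ae_of_all _ fun v hv => ?_)
    rw [uIoc_of_le hz2] at hv
    rcases hv.2.eq_or_lt with h4 | h4
    · simp [hf, h4]
    · simp [hf, halfArc_of_zeta_le h hv.1.le h4]
  rw [h1, intervalIntegral.integral_comp_sub_left f (π / 2), sub_zero,
    show π / 2 - π = -(π / 2) by ring,
    ← intervalIntegral.integral_add_adjacent_intervals (hint (-(π / 2)) 0) (hint 0 (π / 2)), h2,
    ← intervalIntegral.integral_add_adjacent_intervals (hint 0 (zeta ra rs z))
      (hint (zeta ra rs z) (π / 2)), h3, orbitHits]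
  ring

/-- Void exponent of a set whose intersection with each orbit is, up to end points, the arc cut
out by the cap of the points at distance `z` from the platform. -/
lemma lintegral_orbitIntensity {lam mu ra rs z : ℝ} (hlam : 0 ≤ lam) (hmu : 0 ≤ mu)
    (h : 0 ≤ capCos ra rs z) (V : ℝ × ℝ → ℝ≥0∞)
    (hV : ∀ p : ℝ × ℝ, 0 < Real.sin p.2 →
      V p = ENNReal.ofReal (2 * Real.arccos (capCos ra rs z / Real.sin p.2))) :
    ∫⁻ p, (1 - expNeg (ENNReal.ofReal (mu / (2 * π)) * V p)) ∂(orbitIntensity lam) =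
      ENNReal.ofReal (lam * orbitHits mu ra rs z) := by
  have hpi := Real.pi_pos
  have hA := measurable_halfArc ra rs z
  set q : ℝ → ℝ := fun x => Real.sin x * (1 - Real.exp (-(mu / π) * halfArc ra rs z (π / 2 - x)))
    with hq
  have hqm : Measurable q := by
    have : Measurable fun x => halfArc ra rs z (π / 2 - x) := hA.comp (by fun_prop)
    fun_prop
  have hle : ∀ x, Real.exp (-(mu / π) * halfArc ra rs z (π / 2 - x)) ≤ 1 := fun x =>
    exp_neg_mul_le_one (by positivity) (halfArc_nonneg _ _ _ _)
  have hq0 : ∀ x ∈ Ioo 0 π, 0 ≤ q x := fun x hx =>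
    mul_nonneg (Real.sin_pos_of_mem_Ioo hx).le (by linarith [hle x])
  have hpt : ∀ p : ℝ × ℝ, p.2 ∈ Ioo 0 π →
      ENNReal.ofReal (lam * Real.sin p.2 / (2 * π)) *
        (1 - expNeg (ENNReal.ofReal (mu / (2 * π)) * V p)) =
      ENNReal.ofReal (lam / (2 * π)) * ENNReal.ofReal (q p.2) := fun p hp => by
    have hs := Real.sin_pos_of_mem_Ioo hp
    have hc : Real.cos (π / 2 - p.2) = Real.sin p.2 := Real.cos_pi_div_two_sub _
    have hA2 := halfArc_eq_arccos h (v := π / 2 - p.2) (by rwa [hc])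
    rw [hc] at hA2
    have h0 : 0 ≤ Real.arccos (capCos ra rs z / Real.sin p.2) := Real.arccos_nonneg _
    rw [hV p hs, ← ENNReal.ofReal_mul (by positivity), expNeg_ofReal (by positivity),
      ← ENNReal.ofReal_one, ← ENNReal.ofReal_sub _ (Real.exp_pos _).le,
      ← ENNReal.ofReal_mul (by positivity), ← ENNReal.ofReal_mul (by positivity)]
    congr 1
    simp only [hq]
    rw [hA2]
    have : -(mu / (2 * π) * (2 * Real.arccos (capCos ra rs z / Real.sin p.2))) =
        -(mu / π) * Real.arccos (capCos ra rs z / Real.sin p.2) := by field_simp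
    rw [this]; ring
  -- Inclination `0`, where the sine vanishes and `hV` says nothing, is discarded as a null set.
  have hres : (volume.restrict (Ico 0 π ×ˢ Ico 0 π) : Measure (ℝ × ℝ)) =
      (volume.restrict (Ioo 0 π)).prod (volume.restrict (Ioo 0 π)) := by
    rw [Measure.volume_eq_prod, ← Measure.prod_restrict, restrict_Ioo_eq_restrict_Ico]
  have hfin : ∀ x, ENNReal.ofReal x < ∞ := fun x => ENNReal.ofReal_lt_top
  -- `V` is not assumed measurable; finiteness of the density compensates.
  rw [orbitIntensity, lintegral_withDensity_eq_lintegral_mul_non_measurable _ (by fun_prop)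
    (ae_of_all _ fun p => hfin _), hres]
  have hae : ∀ᵐ p : ℝ × ℝ ∂(volume.restrict (Ioo 0 π)).prod (volume.restrict (Ioo 0 π)),
      p.2 ∈ Ioo 0 π :=
    Measure.quasiMeasurePreserving_snd.ae (ae_restrict_mem measurableSet_Ioo)
  simp only [Pi.mul_apply]
  rw [lintegral_congr_ae (hae.mono fun p hp => hpt p hp), lintegral_const_mul _ (by fun_prop),
    lintegral_prod _ (by fun_prop)]
  simp only
  rw [lintegral_const, Measure.restrict_apply_univ, Real.volume_Ioo,
    ← ofReal_integral_eq_lintegral_ofReal ?_ ?_, ← integral_Ioc_eq_integral_Ioo,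
    ← intervalIntegral.integral_of_le hpi.le, integral_sin_mul_eq_orbitHits hmu h,
    ← ENNReal.ofReal_mul' (by linarith), ← ENNReal.ofReal_mul (by positivity)]
  -- `λ/(2π)` times `2 I(z)` from the inclination times `π` from the longitude.
  · congr 1; field_simp; ring
  · refine Integrable.mono' (integrable_const (1 : ℝ)) hqm.aestronglyMeasurable
      (ae_of_all _ fun x => ?_)
    have h2 := Real.exp_pos (-(mu / π) * halfArc ra rs z (π / 2 - x))
    rw [norm_mul]
    exact mul_le_one₀ (Real.abs_sin_le_one x) (norm_nonneg _)
      (by rw [Real.norm_eq_abs, abs_le]; constructor <;> linarith [hle x])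
  · exact (ae_restrict_mem measurableSet_Ioo).mono fun x hx => hq0 x hx

end SatNet

/-! ### Change of variables along an absolutely continuous primitive -/

/-- A Lipschitz function composed with an absolutely continuous one is absolutely continuous. -/
lemma LipschitzOnWith.comp_absolutelyContinuousOnInterval {f g : ℝ → ℝ} {a b : ℝ} {K : ℝ≥0}
    {s : Set ℝ} (hg : LipschitzOnWith K g s) (hf : AbsolutelyContinuousOnInterval f a b)
    (hs : MapsTo f (uIcc a b) s) : AbsolutelyContinuousOnInterval (fun x => g (f x)) a b := by
  have h := Tendsto.const_mul (K : ℝ) hf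
  rw [mul_zero] at h
  refine squeeze_zero' (Eventually.of_forall fun E => Finset.sum_nonneg fun _ _ => dist_nonneg)
    ?_ h
  have : ∀ᶠ E : ℕ × (ℕ → ℝ × ℝ) in AbsolutelyContinuousOnInterval.totalLengthFilter ⊓
      𝓟 (AbsolutelyContinuousOnInterval.disjWithin a b),
      E ∈ AbsolutelyContinuousOnInterval.disjWithin a b := eventually_inf_principal.2 (by simp)
  filter_upwards [this] with E hE
  rw [Finset.mul_sum]
  exact Finset.sum_le_sum fun i hi =>
    hg.dist_le_mul _ (hs (hE.1 i hi).1) _ (hs (hE.1 i hi).2)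

/-- The derivative `c e^{-cx}` is at most `c` on the half-line, though not on the whole line when `c
> 0`. -/
lemma lipschitzOnWith_exp_neg_mul {c : ℝ≥0} :
    LipschitzOnWith c (fun x : ℝ => -Real.exp (-(c * x))) (Ici 0) := by
  refine Convex.lipschitzOnWith_of_nnnorm_hasDerivWithin_le (convex_Ici 0)
    (f' := fun x => c * Real.exp (-(c * x))) (fun x _ => ?_) fun x hx => ?_
  · have := (((hasDerivAt_id x).const_mul (c : ℝ)).fun_neg.exp).fun_neg
    simp only [id, mul_one, mul_neg, neg_neg] at this
    rw [mul_comm]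
    exact this.hasDerivWithinAt
  · rw [← NNReal.coe_le_coe, coe_nnnorm, Real.norm_of_nonneg (by positivity)]
    refine mul_le_of_le_one_right c.coe_nonneg (Real.exp_le_one_iff.2 ?_)
    have : (0 : ℝ) ≤ x := hx
    have := mul_nonneg c.coe_nonneg this
    linarith

/-- Change of variables in the integral of an exponential density, along a primitive. -/
lemma lintegral_mul_exp_neg_primitive {f : ℝ → ℝ≥0∞} (hf : Measurable f) {I : ℝ → ℝ} {a b : ℝ}
    (hab : a ≤ b) (hI : ∀ x ∈ Icc a b, ∫⁻ z in Ioo a x, f z = ENNReal.ofReal (I x))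
    (hI0 : ∀ x ∈ Icc a b, 0 ≤ I x) {c : ℝ} (hc : 0 ≤ c) :
    ∫⁻ z in Ioo a b, ENNReal.ofReal (c * Real.exp (-(c * I z))) * f z =
      ENNReal.ofReal (1 - Real.exp (-(c * I b))) := by
  lift c to ℝ≥0 using hc
  have hIa : I a = 0 := by
    have h := hI a (left_mem_Icc.2 hab)
    simp only [Ioo_self, Measure.restrict_empty, lintegral_zero_measure] at h
    exact le_antisymm (ENNReal.ofReal_eq_zero.1 h.symm) (hI0 a (left_mem_Icc.2 hab))
  have hfin : ∫⁻ z in Ioo a b, f z ≠ ∞ := by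
    rw [hI b (right_mem_Icc.2 hab)]; exact ENNReal.ofReal_ne_top
  have hlt : ∀ᵐ z ∂volume.restrict (Ioo a b), f z < ∞ := ae_lt_top hf hfin
  have hint : IntegrableOn (fun z => (f z).toReal) (Ioo a b) :=
    integrable_toReal_of_lintegral_ne_top hf.aemeasurable hfin
  have hii : IntervalIntegrable (fun z => (f z).toReal) volume a b :=
    (intervalIntegrable_iff_integrableOn_Ioo_of_le hab).2 hint
  have hF : ∀ x ∈ Icc a b, ∫ z in a..x, (f z).toReal = I x := fun x hx => by
    rw [intervalIntegral.integral_of_le hx.1, integral_Ioc_eq_integral_Ioo,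
      integral_toReal hf.aemeasurable
        (ae_restrict_of_ae_restrict_of_subset (Ioo_subset_Ioo_right hx.2) hlt), hI x hx,
      ENNReal.toReal_ofReal (hI0 x hx)]
  set g : ℝ → ℝ := fun x => -Real.exp (-(c * ∫ z in a..x, (f z).toReal)) with hg
  -- As `f` is only integrable, `g` is known to be differentiable only almost everywhere; absolute
  -- continuity still gives the fundamental theorem of calculus.
  have hgac : AbsolutelyContinuousOnInterval g a b := by
    refine lipschitzOnWith_exp_neg_mul.comp_absolutelyContinuousOnInterval
      (hii.absolutelyContinuousOnInterval_intervalIntegral left_mem_uIcc) fun x hx => ?_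
    rw [uIcc_of_le hab] at hx
    rw [hF x hx]
    exact hI0 x hx
  have hderiv : ∀ᵐ x ∂volume.restrict (Ioo a b),
      deriv g x = c * Real.exp (-(c * I x)) * (f x).toReal := by
    rw [ae_restrict_iff' measurableSet_Ioo]
    filter_upwards [hii.ae_hasDerivAt_integral] with x hx hxab
    have hx' : x ∈ uIcc a b := by rw [uIcc_of_le hab]; exact Ioo_subset_Icc_self hxab
    have h := (((hx hx' a left_mem_uIcc).const_mul (c : ℝ)).fun_neg.exp).fun_neg
    rw [h.deriv, hF x (Ioo_subset_Icc_self hxab)]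
    ring
  have hsub := hgac.integral_deriv_eq_sub
  have hdint := hgac.intervalIntegrable_deriv
  rw [intervalIntegrable_iff_integrableOn_Ioo_of_le hab] at hdint
  rw [intervalIntegral.integral_of_le hab, integral_Ioc_eq_integral_Ioo] at hsub
  have hval : g b - g a = 1 - Real.exp (-(c * I b)) := by
    simp only [hg]
    rw [hF b (right_mem_Icc.2 hab), hF a (left_mem_Icc.2 hab), hIa]
    simp; ring
  rw [← hval, ← hsub, ofReal_integral_eq_lintegral_ofReal hdint]
  · refine lintegral_congr_ae ?_
    filter_upwards [hderiv, hlt] with x hx hfx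
    rw [hx, ENNReal.ofReal_mul (p := c * Real.exp (-(c * I x))) (by positivity),
      ENNReal.ofReal_toReal hfx.ne]
  · filter_upwards [hderiv] with x hx
    rw [hx]
    exact mul_nonneg (by positivity) ENNReal.toReal_nonneg

namespace SatNet

/-! ### The derivative of the mean number of orbits with a satellite in a cap -/

/-- The derivative with respect to `z` of the integrand of `orbitHits`. -/
noncomputable def hitsKernel (mu ra rs z v : ℝ) : ℝ :=
  mu / π * (z / (rs * ra)) * Real.exp (-(mu / π) * halfArc ra rs z v)
    / √(1 - Real.cos (zeta ra rs z) ^ 2 / Real.cos v ^ 2)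

/-- The derivative of `orbitHits`. -/
noncomputable def hitsDensity (mu ra rs z : ℝ) : ℝ≥0∞ :=
  ∫⁻ v in Ioo 0 (zeta ra rs z), ENNReal.ofReal (hitsKernel mu ra rs z v)

lemma measurable_zeta (ra rs : ℝ) : Measurable (zeta ra rs) := by
  unfold zeta
  exact Real.continuous_arccos.measurable.comp (by fun_prop)

lemma measurable_hitsKernel (mu ra rs : ℝ) :
    Measurable fun q : ℝ × ℝ => hitsKernel mu ra rs q.1 q.2 := by
  have hz : Measurable fun q : ℝ × ℝ => zeta ra rs q.1 :=
    (measurable_zeta ra rs).comp measurable_fst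
  have hA : Measurable fun q : ℝ × ℝ => halfArc ra rs q.1 q.2 :=
    Real.continuous_arcsin.measurable.comp (by fun_prop)
  unfold hitsKernel
  fun_prop

/-- The constraint `v < ζ(z)` becomes an indicator, so that Tonelli can be applied on a product. -/
lemma measurable_indicator_hitsKernel (mu ra rs : ℝ) :
    Measurable fun q : ℝ × ℝ =>
      (Iio (zeta ra rs q.1)).indicator
        (fun v => ENNReal.ofReal (hitsKernel mu ra rs q.1 v)) q.2 := by
  have hS : MeasurableSet {q : ℝ × ℝ | q.2 < zeta ra rs q.1} :=
    measurableSet_lt measurable_snd ((measurable_zeta ra rs).comp measurable_fst)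
  exact ((measurable_hitsKernel mu ra rs).ennreal_ofReal.indicator hS)

lemma setLIntegral_indicator_Iio (f : ℝ → ℝ≥0∞) {b c : ℝ} (hbc : b ≤ c) :
    ∫⁻ v in Ioo 0 c, (Iio b).indicator f v = ∫⁻ v in Ioo 0 b, f v := by
  rw [setLIntegral_indicator measurableSet_Iio]
  congr 2
  ext v
  simp only [mem_inter_iff, mem_Iio, mem_Ioo]
  constructor
  · rintro ⟨h1, h2, h3⟩; exact ⟨h2, h1⟩
  · rintro ⟨h1, h2⟩; exact ⟨h2, h1, h2.trans_le hbc⟩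

lemma measurable_hitsDensity (mu ra rs : ℝ) : Measurable (hitsDensity mu ra rs) := by
  have h : hitsDensity mu ra rs = fun z => ∫⁻ v in Ioo 0 π,
      (Iio (zeta ra rs z)).indicator (fun v => ENNReal.ofReal (hitsKernel mu ra rs z v)) v := by
    funext z
    have hz : zeta ra rs z ≤ π := Real.arccos_le_pi _
    rw [setLIntegral_indicator_Iio _ hz, hitsDensity]
  rw [h]
  exact (measurable_indicator_hitsKernel mu ra rs).lintegral_prod_right'

lemma capCos_le_capCos {ra rs z x : ℝ} (hra : 0 < ra) (hrs : 0 < rs) (hz : 0 ≤ z) (hzx : z ≤ x) :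
    capCos ra rs x ≤ capCos ra rs z := by
  unfold capCos
  gcongr

/-- Together with `capCos_lt_cos_iff`, this rewrites `v < ζ(z)` as a lower bound on `z`, as the
exchange of integrals requires. -/
lemma lt_zeta_iff {ra rs z v : ℝ} (h : 0 ≤ capCos ra rs z) (hv0 : 0 ≤ v) (hv : v ≤ π / 2) :
    v < zeta ra rs z ↔ capCos ra rs z < Real.cos v := by
  have hpi := Real.pi_pos
  constructor
  · intro hlt
    have h1 := Real.cos_lt_cos_of_nonneg_of_le_pi hv0 (Real.arccos_le_pi _) hlt
    rw [← zeta, cos_zeta h, min_lt_iff] at h1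
    exact h1.resolve_right (not_lt.2 (Real.cos_le_one v))
  · intro hlt
    by_contra! hle
    have h1 := Real.cos_le_cos_of_nonneg_of_le_pi (zeta_nonneg ra rs z) (by linarith) hle
    rw [cos_zeta h] at h1
    exact absurd (h1.trans (min_le_left _ _)) (not_le.2 hlt)

/-- The distance from the platform to the highest point of an orbit at angle `v` from the pole. -/
noncomputable def orbitDist (ra rs v : ℝ) : ℝ := √(rs ^ 2 + ra ^ 2 - 2 * rs * ra * Real.cos v)

lemma orbitDist_sq {ra rs : ℝ} (hra : 0 < ra) (hrs : 0 < rs) (v : ℝ) :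
    orbitDist ra rs v ^ 2 = rs ^ 2 + ra ^ 2 - 2 * rs * ra * Real.cos v := by
  refine Real.sq_sqrt ?_
  nlinarith [Real.cos_le_one v, sq_nonneg (rs - ra), mul_pos hrs hra]

lemma capCos_orbitDist {ra rs : ℝ} (hra : 0 < ra) (hrs : 0 < rs) (v : ℝ) :
    capCos ra rs (orbitDist ra rs v) = Real.cos v := by
  rw [capCos, orbitDist_sq hra hrs]
  field_simp
  ring

lemma capCos_lt_cos_iff {ra rs z : ℝ} (hra : 0 < ra) (hrs : 0 < rs) (hz : 0 < z) (v : ℝ) :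
    capCos ra rs z < Real.cos v ↔ orbitDist ra rs v < z := by
  rw [orbitDist, Real.sqrt_lt' hz, capCos, div_lt_iff₀ (by positivity)]
  constructor <;> intro h <;> linarith

lemma sub_lt_orbitDist {ra rs v : ℝ} (hra : 0 < ra) (hrs : ra < rs) (hv : Real.cos v < 1) :
    rs - ra < orbitDist ra rs v := by
  refine Real.lt_sqrt_of_sq_lt ?_
  nlinarith [mul_pos hra (hra.trans hrs)]

lemma hitsKernel_nonneg {mu ra rs z : ℝ} (hmu : 0 ≤ mu) (hra : 0 < ra) (hrs : 0 < rs)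
    (hz : 0 ≤ z) (v : ℝ) : 0 ≤ hitsKernel mu ra rs z v := by
  unfold hitsKernel
  positivity

/-- For fixed `v`, the integral of the kernel over `z`. -/
lemma lintegral_hitsKernel {mu ra rs v x : ℝ} (hmu : 0 ≤ mu) (hra : 0 < ra) (hrs : ra < rs)
    (hv0 : 0 < v) (hv : v < π / 2) (hx : 0 ≤ capCos ra rs x) (hvx : orbitDist ra rs v ≤ x) :
    ∫⁻ z in Ioo (orbitDist ra rs v) x, ENNReal.ofReal (hitsKernel mu ra rs z v) =
      ENNReal.ofReal (Real.cos v * (1 - Real.exp (-(mu / π) * halfArc ra rs x v))) := by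
  have hrs0 := hra.trans hrs
  have hpi := Real.pi_pos
  have hcos : 0 < Real.cos v := Real.cos_pos_of_mem_Ioo ⟨by linarith, hv⟩
  have hcos1 : Real.cos v < 1 := by
    have := Real.cos_lt_cos_of_nonneg_of_le_pi le_rfl (by linarith) hv0
    rwa [Real.cos_zero] at this
  have hd := sub_lt_orbitDist hra hrs hcos1
  set a := orbitDist ra rs v with ha
  -- The primitive of the kernel in `z`. Its factor `cos v` cancels the `1 / cos v` of the chain
  -- rule, and it vanishes at `a`, where the arccosine is taken at `1`.
  set G : ℝ → ℝ := fun z =>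
    Real.cos v * (1 - Real.exp (-(mu / π) * Real.arccos (capCos ra rs z / Real.cos v))) with hG
  have hGc : Continuous G := by
    have : Continuous fun z => Real.arccos (capCos ra rs z / Real.cos v) :=
      Real.continuous_arccos.comp (by unfold capCos; fun_prop)
    fun_prop
  have hderiv : ∀ z ∈ Ioo a x, HasDerivAt G (hitsKernel mu ra rs z v) z := fun z hz => by
    have hz0 : 0 < z := by linarith [hz.1]
    have hC0 : 0 ≤ capCos ra rs z := hx.trans (capCos_le_capCos hra hrs0 hz0.le hz.2.le)
    have hC1 : capCos ra rs z < Real.cos v := (capCos_lt_cos_iff hra hrs0 hz0 v).2 hz.1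
    have hX0 : 0 ≤ capCos ra rs z / Real.cos v := by positivity
    have hX1 : capCos ra rs z / Real.cos v < 1 := (div_lt_one hcos).2 hC1
    have h1 : HasDerivAt (fun z => capCos ra rs z / Real.cos v)
        (-(2 * z) / (2 * rs * ra) / Real.cos v) z := by
      have := (((hasDerivAt_pow 2 z).const_sub (rs ^ 2 + ra ^ 2)).div_const
        (2 * rs * ra)).div_const (Real.cos v)
      simpa [capCos] using this
    have h2 := (Real.hasDerivAt_arccos (x := capCos ra rs z / Real.cos v)
      (by linarith) hX1.ne).comp z h1
    have h3 := ((h2.const_mul (-(mu / π))).exp.const_sub 1).const_mul (Real.cos v)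
    refine h3.congr_deriv ?_
    rw [hitsKernel, halfArc_eq_arccos hC0 hcos, cos_zeta hC0, min_eq_left (by linarith), ← div_pow]
    have hsq : √(1 - (capCos ra rs z / Real.cos v) ^ 2) ≠ 0 :=
      (Real.sqrt_pos.2 (by nlinarith)).ne'
    simp only [Function.comp]
    field_simp
  have hnn : ∀ z ∈ Ioo a x, 0 ≤ hitsKernel mu ra rs z v := fun z hz =>
    hitsKernel_nonneg hmu hra hrs0 (by linarith [hz.1]) v
  -- The square root in the denominator tends to `0` at the left end point; integrability comes from
  -- the sign of the derivative.
  have hint := intervalIntegral.integrableOn_deriv_of_nonneg hGc.continuousOn hderiv hnn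
  have hftc := intervalIntegral.integral_eq_sub_of_hasDerivAt_of_le hvx hGc.continuousOn hderiv
    ((intervalIntegrable_iff_integrableOn_Ioc_of_le hvx).2 hint)
  rw [← ofReal_integral_eq_lintegral_ofReal (hint.mono_set Ioo_subset_Ioc_self)
    ((ae_restrict_mem measurableSet_Ioo).mono hnn), ← integral_Ioc_eq_integral_Ioo,
    ← intervalIntegral.integral_of_le hvx, hftc, halfArc_eq_arccos hx hcos]
  simp only [hG]
  rw [ha, capCos_orbitDist hra hrs0, div_self hcos.ne']
  simp

lemma orbitHits_eq_lintegral {mu ra rs x : ℝ} (hmu : 0 ≤ mu) (hx : 0 ≤ capCos ra rs x) :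
    ∫⁻ v in Ioo 0 (zeta ra rs x),
      ENNReal.ofReal (Real.cos v * (1 - Real.exp (-(mu / π) * halfArc ra rs x v))) =
      ENNReal.ofReal (orbitHits mu ra rs x) := by
  have h0 := zeta_nonneg ra rs x
  have hi := intervalIntegrable_cos_mul_one_sub_exp hmu ra rs x 0 (zeta ra rs x)
  rw [orbitHits, intervalIntegral.integral_of_le h0, integral_Ioc_eq_integral_Ioo,
    ofReal_integral_eq_lintegral_ofReal ((intervalIntegrable_iff_integrableOn_Ioo_of_le h0).1 hi)]
  refine (ae_restrict_mem measurableSet_Ioo).mono fun v hv => mul_nonneg ?_ ?_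
  · have := zeta_le_pi_div_two hx
    exact (Real.cos_pos_of_mem_Ioo ⟨by linarith [hv.1, Real.pi_pos], hv.2.trans_le this⟩).le
  · linarith [exp_neg_mul_le_one (c := mu / π) (by positivity) (halfArc_nonneg ra rs x v)]

lemma orbitHits_nonneg {mu ra rs x : ℝ} (hmu : 0 ≤ mu) (hx : 0 ≤ capCos ra rs x) :
    0 ≤ orbitHits mu ra rs x := by
  have h0 := zeta_nonneg ra rs x
  refine intervalIntegral.integral_nonneg h0 fun v hv => mul_nonneg ?_ ?_
  · have := zeta_le_pi_div_two hx
    exact Real.cos_nonneg_of_mem_Icc ⟨by linarith [hv.1, Real.pi_pos], hv.2.trans this⟩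
  · linarith [exp_neg_mul_le_one (c := mu / π) (by positivity) (halfArc_nonneg ra rs x v)]

/-- `hitsDensity` is the derivative of `orbitHits`. -/
lemma lintegral_hitsDensity {mu ra rs x : ℝ} (hmu : 0 ≤ mu) (hra : 0 < ra) (hrs : ra < rs)
    (hxr : rs - ra ≤ x) (hx : 0 ≤ capCos ra rs x) :
    ∫⁻ z in Ioo (rs - ra) x, hitsDensity mu ra rs z = ENNReal.ofReal (orbitHits mu ra rs x) := by
  have hrs0 := hra.trans hrs
  have hpi := Real.pi_pos
  have hC : ∀ z ∈ Ioo (rs - ra) x, 0 ≤ capCos ra rs z := fun z hz =>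
    hx.trans (capCos_le_capCos hra hrs0 (by linarith [hz.1]) hz.2.le)
  rw [← orbitHits_eq_lintegral hmu hx]
  have h1 : ∫⁻ z in Ioo (rs - ra) x, hitsDensity mu ra rs z =
      ∫⁻ z in Ioo (rs - ra) x, ∫⁻ v in Ioo 0 (zeta ra rs x),
        (Iio (zeta ra rs z)).indicator (fun v => ENNReal.ofReal (hitsKernel mu ra rs z v)) v := by
    refine setLIntegral_congr_fun measurableSet_Ioo fun z hz => ?_
    rw [setLIntegral_indicator_Iio, hitsDensity]
    exact Real.antitone_arccos (capCos_le_capCos hra hrs0 (by linarith [hz.1]) hz.2.le)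
  rw [h1, lintegral_lintegral_swap (measurable_indicator_hitsKernel mu ra rs).aemeasurable]
  refine setLIntegral_congr_fun measurableSet_Ioo fun v hv => ?_
  have hv2 : v < π / 2 := hv.2.trans_le (zeta_le_pi_div_two hx)
  have hcos1 : Real.cos v < 1 := by
    have := Real.cos_lt_cos_of_nonneg_of_le_pi le_rfl (by linarith) hv.1
    rwa [Real.cos_zero] at this
  have hd := sub_lt_orbitDist hra hrs hcos1
  have hvx : orbitDist ra rs v ≤ x :=
    ((capCos_lt_cos_iff hra hrs0 (by linarith) v).1 ((lt_zeta_iff hx hv.1.le hv2.le).1 hv.2)).le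
  rw [← lintegral_hitsKernel hmu hra hrs hv.1 hv2 hx hvx]
  -- For fixed `v`, the orbit enters the cap once `z` exceeds the distance to its highest point.
  have h2 : Ioo (orbitDist ra rs v) x = Ioo (rs - ra) x ∩ Ioi (orbitDist ra rs v) := by
    ext z
    simp only [mem_inter_iff, mem_Ioo, mem_Ioi]
    constructor
    · rintro ⟨h3, h4⟩; exact ⟨⟨hd.trans h3, h4⟩, h3⟩
    · rintro ⟨⟨h3, h4⟩, h5⟩; exact ⟨h5, h4⟩
  rw [h2, inter_comm, ← setLIntegral_indicator measurableSet_Ioi]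
  refine setLIntegral_congr_fun measurableSet_Ioo fun z hz => ?_
  have hiff : v < zeta ra rs z ↔ orbitDist ra rs v < z :=
    (lt_zeta_iff (hC z hz) hv.1.le hv2.le).trans
      (capCos_lt_cos_iff hra hrs0 (by linarith [hz.1]) v)
  by_cases h : v < zeta ra rs z
  · simp [indicator, h, hiff.1 h]
  · simp [indicator, h, mt hiff.2 h]

/-- The density of the distance to the nearest satellite. -/
noncomputable def distDensity (lam mu ra rs z : ℝ) : ℝ≥0∞ :=
  ENNReal.ofReal (lam * Real.exp (-(lam * orbitHits mu ra rs z))) * hitsDensity mu ra rs z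

/-! ### The law of the distance to the nearest satellite -/

lemma phiBar_pos {re ra rs : ℝ} (hre : 0 < re) (hea : re < ra) : 0 < phiBar re ra rs := by
  have h1 : 0 < Real.arccos (re / ra) :=
    Real.arccos_pos.2 ((div_lt_one (hre.trans hea)).2 hea)
  have h2 := Real.arccos_nonneg (re / rs)
  unfold phiBar
  linarith

lemma capCos_capDist {re ra rs : ℝ} (hra : 0 < ra) (hrs : 0 < rs) :
    capCos ra rs (capDist re ra rs) = Real.cos (phiBar re ra rs) :=
  capCos_orbitDist hra hrs _

lemma sub_lt_capDist {re ra rs : ℝ} (hre : 0 < re) (hea : re < ra) (has : ra < rs)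
    (h : phiBar re ra rs ≤ π / 2) : rs - ra < capDist re ra rs := by
  refine sub_lt_orbitDist (hre.trans hea) has ?_
  have := Real.cos_lt_cos_of_nonneg_of_le_pi le_rfl (by linarith [Real.pi_pos])
    (phiBar_pos (rs := rs) hre hea)
  rwa [Real.cos_zero] at this

/-- The bound on `phiBar` keeps the cap in the upper half-space, where the arc formulas hold. -/
lemma capCos_capDist_nonneg {re ra rs : ℝ} (hre : 0 < re) (hea : re < ra) (has : ra < rs)
    (h : phiBar re ra rs ≤ π / 2) : 0 ≤ capCos ra rs (capDist re ra rs) := by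
  rw [capCos_capDist (hre.trans hea) (hre.trans (hea.trans has))]
  exact Real.cos_nonneg_of_mem_Icc
    ⟨by linarith [Real.pi_pos, phiBar_pos (rs := rs) hre hea], h⟩

/-- The tail of the law of the distance to the nearest satellite of the cap. -/
lemma prob_le_nearestDist {Ω : Type*} [MeasurableSpace Ω] {P : Measure Ω} [IsProbabilityMeasure P]
    {ra rs d lam mu : ℝ} (hra : 0 < ra) (hrs : 0 < rs) (hd0 : 0 ≤ d) (hd : 0 ≤ capCos ra rs d)
    (hlam : 0 ≤ lam) (hmu : 0 ≤ mu)
    {Ξ : Ω → Measure (ℝ × ℝ)} {Ψ : Ω → Measure E3}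
    (hΞ : IsPoissonProcess P Ξ (orbitIntensity lam))
    (hΨ : IsCoxProcess P Ψ Ξ (satelliteIntensity rs mu)) (a : ℝ≥0∞) :
    P {ω | a ≤ nearestDist (polePoint ra) (sphericalCap rs (polePoint ra) d) (Ψ ω)} =
      ENNReal.ofReal
        (Real.exp (-(lam * orbitHits mu ra rs (min a (ENNReal.ofReal d)).toReal))) := by
  set m : ℝ := (min a (ENNReal.ofReal d)).toReal with hm
  have hm0 : 0 ≤ m := ENNReal.toReal_nonneg
  have hofm : ENNReal.ofReal m = min a (ENNReal.ofReal d) :=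
    ENNReal.ofReal_toReal (ne_top_of_le_ne_top ENNReal.ofReal_ne_top (min_le_right _ _))
  have hmd : m ≤ d := by
    rw [← ENNReal.ofReal_le_ofReal_iff hd0, hofm]; exact min_le_right _ _
  have hCm : 0 ≤ capCos ra rs m := hd.trans (capCos_le_capCos hra hrs hm0 hmd)
  set S := sphericalCap rs (polePoint ra) d with hS
  have hSm : MeasurableSet S := measurableSet_sphericalCap _ _ _
  set B : Set E3 := {y | y ∈ S ∧ edist (polePoint ra) y < a} with hB
  have hBm : MeasurableSet B :=
    hSm.inter (measurableSet_lt (measurable_const.edist measurable_id) measurable_const)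
  have hset : {ω | a ≤ nearestDist (polePoint ra) S (Ψ ω)} = {ω | Ψ ω B = 0} := by
    ext ω
    have := nearestDist_lt_iff (hΨ.isPointProcess.counting ω) hSm (x := polePoint ra) a
    rw [mem_ofPred_eq, mem_ofPred_eq, ← not_lt, this, not_not]
  have hedist : ∀ y : E3, edist (polePoint ra) y = ENNReal.ofReal ‖y - polePoint ra‖ := fun y => by
    rw [edist_comm, edist_dist, dist_eq_norm]
  rw [hset, prob_void hrs hmu hΞ hΨ hBm, lintegral_orbitIntensity hlam hmu hCm,
    expNeg_ofReal (mul_nonneg hlam (orbitHits_nonneg hmu hCm))]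
  intro p hp
  -- `B` is the cap of radius `m`, with its boundary if `d < a` and without it if `a ≤ d`; the arc
  -- lengths are the same.
  refine volume_arc_of_sin hp hCm (fun w hw hlt => ⟨hw, ?_⟩) fun w hw => ⟨hw.1, ?_⟩
  · have h1 := (norm_orbitPoint_sub_lt_iff hra hrs hm0 p w).2 hlt
    refine ⟨⟨norm_orbitPoint hrs.le p w, (h1.trans_le hmd).le⟩, ?_⟩
    rw [hedist]
    refine lt_of_lt_of_le ?_ (hofm.trans_le (min_le_left _ _))
    exact (ENNReal.ofReal_lt_ofReal_iff (lt_of_le_of_lt (norm_nonneg _) h1)).2 h1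
  · rw [← norm_orbitPoint_sub_le_iff hra hrs hm0, ← ENNReal.ofReal_le_ofReal_iff hm0, hofm,
      le_min_iff, ← hedist]
    refine ⟨hw.2.2.le, ?_⟩
    rw [hedist]
    exact ENNReal.ofReal_le_ofReal hw.2.1.2

lemma measurable_orbitHits (mu ra rs : ℝ) : Measurable (orbitHits mu ra rs) := by
  have hz : Measurable fun q : ℝ × ℝ => zeta ra rs q.1 :=
    (measurable_zeta ra rs).comp measurable_fst
  have hA : Measurable fun q : ℝ × ℝ => halfArc ra rs q.1 q.2 :=
    Real.continuous_arcsin.measurable.comp (by fun_prop)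
  have hS : MeasurableSet {q : ℝ × ℝ | q.2 ∈ Ioc 0 (zeta ra rs q.1)} :=
    (measurableSet_lt measurable_const measurable_snd).inter (measurableSet_le measurable_snd hz)
  have hf : Measurable fun q : ℝ × ℝ =>
      Real.cos q.2 * (1 - Real.exp (-(mu / π) * halfArc ra rs q.1 q.2)) := by fun_prop
  have h : orbitHits mu ra rs = fun z => ∫ v, (Ioc 0 (zeta ra rs z)).indicator
      (fun v => Real.cos v * (1 - Real.exp (-(mu / π) * halfArc ra rs z v))) v := by
    funext z
    rw [integral_indicator measurableSet_Ioc, orbitHits,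
      intervalIntegral.integral_of_le (zeta_nonneg ra rs z)]
  rw [h]
  exact ((hf.indicator hS).stronglyMeasurable.integral_prod_right').measurable

lemma measurable_distDensity (lam mu ra rs : ℝ) : Measurable (distDensity lam mu ra rs) := by
  have hI := measurable_orbitHits mu ra rs
  have := measurable_hitsDensity mu ra rs
  unfold distDensity
  fun_prop

/-- No point of the sphere is nearer to the platform than `rs - ra`. -/
lemma orbitHits_of_le {mu ra rs z : ℝ} (hra : 0 < ra) (hrs : 0 < rs) (hz : 0 ≤ z)
    (hzr : z ≤ rs - ra) : orbitHits mu ra rs z = 0 := by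
  have h : zeta ra rs z = 0 := by
    rw [zeta, Real.arccos_eq_zero, one_le_div (by positivity)]
    nlinarith
  rw [orbitHits, h, intervalIntegral.integral_same]

lemma lintegral_distDensity {lam mu ra rs x : ℝ} (hlam : 0 ≤ lam) (hmu : 0 ≤ mu) (hra : 0 < ra)
    (hrs : ra < rs) (hxr : rs - ra ≤ x) (hx : 0 ≤ capCos ra rs x) :
    ∫⁻ z in Ioo (rs - ra) x, distDensity lam mu ra rs z =
      ENNReal.ofReal (1 - Real.exp (-(lam * orbitHits mu ra rs x))) := by
  have hC : ∀ z ∈ Icc (rs - ra) x, 0 ≤ capCos ra rs z := fun z hz =>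
    hx.trans (capCos_le_capCos hra (hra.trans hrs) (by linarith [hz.1]) hz.2)
  exact lintegral_mul_exp_neg_primitive (measurable_hitsDensity mu ra rs) hxr
    (fun z hz => lintegral_hitsDensity hmu hra hrs hz.1 (hC z hz))
    (fun z hz => orbitHits_nonneg hmu (hC z hz)) hlam

/-- The tail of the distance, split into its density part and the mass of the event of an empty cap;
the additive form avoids truncated subtraction. -/
lemma lintegral_distDensity_add {lam mu ra rs m d : ℝ} (hlam : 0 ≤ lam) (hmu : 0 ≤ mu)
    (hra : 0 < ra) (hrs : ra < rs) (hm : rs - ra ≤ m) (hmd : m ≤ d) (hd : 0 ≤ capCos ra rs d) :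
    (∫⁻ z in Ioo m d, distDensity lam mu ra rs z) +
        ENNReal.ofReal (Real.exp (-(lam * orbitHits mu ra rs d))) =
      ENNReal.ofReal (Real.exp (-(lam * orbitHits mu ra rs m))) := by
  have hCm : 0 ≤ capCos ra rs m :=
    hd.trans (capCos_le_capCos hra (hra.trans hrs) (by linarith) hmd)
  have hle : ∀ x, 0 ≤ capCos ra rs x → 0 ≤ 1 - Real.exp (-(lam * orbitHits mu ra rs x)) :=
    fun x hx => sub_nonneg.2
      (Real.exp_le_one_iff.2 (neg_nonpos.2 (mul_nonneg hlam (orbitHits_nonneg hmu hx))))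
  have h1 := lintegral_distDensity hlam hmu hra hrs (hm.trans hmd) hd
  have h2 := lintegral_distDensity hlam hmu hra hrs hm hCm
  have hsplit : ∫⁻ z in Ioo (rs - ra) d, distDensity lam mu ra rs z =
      (∫⁻ z in Ioo (rs - ra) m, distDensity lam mu ra rs z) +
        ∫⁻ z in Ioo m d, distDensity lam mu ra rs z := by
    rw [restrict_Ioo_eq_restrict_Ioc (a := rs - ra) (b := m),
      restrict_Ioo_eq_restrict_Ioc (a := m) (b := d),
      restrict_Ioo_eq_restrict_Ioc (a := rs - ra) (b := d),
      ← lintegral_union measurableSet_Ioc (Ioc_disjoint_Ioc_of_le le_rfl),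
      Ioc_union_Ioc_eq_Ioc hm hmd]
  rw [hsplit, h2] at h1
  refine (ENNReal.add_right_inj (a := ENNReal.ofReal (1 - Real.exp (-(lam * orbitHits mu ra rs m))))
    ENNReal.ofReal_ne_top).1 ?_
  rw [← add_assoc, h1, ← ENNReal.ofReal_add (hle d hd) (Real.exp_pos _).le,
    ← ENNReal.ofReal_add (hle m hCm) (Real.exp_pos _).le]
  simp

/-- The law of the distance from the platform to the nearest satellite of the cap. -/
theorem map_nearestDist {Ω : Type*} [MeasurableSpace Ω] {P : Measure Ω} [IsProbabilityMeasure P]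
    {ra rs d lam mu : ℝ} (hra : 0 < ra) (hrs : ra < rs) (hdr : rs - ra ≤ d)
    (hd : 0 ≤ capCos ra rs d) (hlam : 0 ≤ lam) (hmu : 0 ≤ mu)
    {Ξ : Ω → Measure (ℝ × ℝ)} {Ψ : Ω → Measure E3}
    (hΞ : IsPoissonProcess P Ξ (orbitIntensity lam))
    (hΨ : IsCoxProcess P Ψ Ξ (satelliteIntensity rs mu)) :
    P.map (fun ω => nearestDist (polePoint ra) (sphericalCap rs (polePoint ra) d) (Ψ ω)) =
      ((volume.restrict (Ioo (rs - ra) d)).withDensity (distDensity lam mu ra rs)).map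
          ENNReal.ofReal +
        ENNReal.ofReal (Real.exp (-(lam * orbitHits mu ra rs d))) • Measure.dirac ∞ := by
  have hrs0 := hra.trans hrs
  have hd0 : 0 ≤ d := by linarith
  have hDm := measurable_nearestDist hΨ.1.1 hΨ.1.2 (polePoint ra)
    (measurableSet_sphericalCap rs (polePoint ra) d)
  have : IsProbabilityMeasure (P.map fun ω =>
      nearestDist (polePoint ra) (sphericalCap rs (polePoint ra) d) (Ψ ω)) :=
    Measure.isProbabilityMeasure_map hDm.aemeasurable
  -- Both laws are compared through their tails on `[0, ∞]`; the atom at `∞` lies in every `Ici a`.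
  refine Measure.ext_of_Ici _ _ fun a => ?_
  have hpre : (fun ω => nearestDist (polePoint ra) (sphericalCap rs (polePoint ra) d) (Ψ ω)) ⁻¹'
      Ici a = {ω | a ≤ nearestDist (polePoint ra) (sphericalCap rs (polePoint ra) d) (Ψ ω)} := rfl
  set m : ℝ := (min a (ENNReal.ofReal d)).toReal with hm
  have hm0 : 0 ≤ m := ENNReal.toReal_nonneg
  have hofm : ENNReal.ofReal m = min a (ENNReal.ofReal d) :=
    ENNReal.ofReal_toReal (ne_top_of_le_ne_top ENNReal.ofReal_ne_top (min_le_right _ _))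
  have hmd : m ≤ d := by
    rw [← ENNReal.ofReal_le_ofReal_iff hd0, hofm]; exact min_le_right _ _
  have hH : orbitHits mu ra rs m = orbitHits mu ra rs (max m (rs - ra)) := by
    rcases le_total m (rs - ra) with h | h
    · rw [max_eq_right h, orbitHits_of_le hra hrs0 hm0 h,
        orbitHits_of_le hra hrs0 (by linarith) le_rfl]
    · rw [max_eq_left h]
  rw [Measure.map_apply hDm measurableSet_Ici, hpre,
    prob_le_nearestDist hra hrs0 hd0 hd hlam hmu hΞ hΨ, ← hm, hH,
    ← lintegral_distDensity_add hlam hmu hra hrs (le_max_right m (rs - ra)) (max_le hmd hdr) hd,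
    Measure.add_apply, Measure.map_apply ENNReal.measurable_ofReal measurableSet_Ici,
    Measure.smul_apply, Measure.dirac_apply' _ measurableSet_Ici,
    indicator_of_mem (mem_Ici.2 (le_top (a := a))), Pi.one_apply, smul_eq_mul, mul_one]
  congr 1
  have hmeas : MeasurableSet (ENNReal.ofReal ⁻¹' Ici a) :=
    ENNReal.measurable_ofReal measurableSet_Ici
  rw [withDensity_apply _ hmeas, Measure.restrict_restrict hmeas]
  refine setLIntegral_congr ?_
  have h1 : ENNReal.ofReal ⁻¹' Ici a ∩ Ioo (rs - ra) d = Ici m ∩ Ioo (rs - ra) d := by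
    ext z
    refine and_congr_left fun hz => ?_
    have hz0 : 0 ≤ z := by linarith [hz.1]
    rw [mem_preimage, mem_Ici, mem_Ici, ← ENNReal.ofReal_le_ofReal_iff hz0, hofm, min_le_iff]
    exact (or_iff_left (not_le.2 ((ENNReal.ofReal_lt_ofReal_iff (by linarith [hz.1, hz.2])).2
      hz.2))).symm
  have h2 : Ioi m ∩ Ioo (rs - ra) d = Ioo (max m (rs - ra)) d := by
    ext z
    simp only [mem_inter_iff, mem_Ioi, mem_Ioo, max_lt_iff]
    tauto
  rw [h1, ← h2]
  have h3 : (Ioi m : Set ℝ) =ᵐ[volume] Ici m := Ioi_ae_eq_Ici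
  exact h3.inter (ae_eq_refl _)

/-! ### Achievable rates -/

lemma two_rpow_sub_one_pos {u : ℝ} (hu : 0 < u) : 0 < (2 : ℝ) ^ u - 1 :=
  sub_pos.2 (Real.one_lt_rpow one_lt_two hu)

lemma two_rpow_sub_one_injective : Function.Injective fun u : ℝ => (2 : ℝ) ^ u - 1 := fun _ _ h =>
  (Real.strictMono_rpow_of_base_gt_one one_lt_two).injective (sub_left_injective h)

/-- The achievable rate as an integral of the coverage probability. -/
lemma achievableRate_eq_tailIntegral {Ω : Type*} [MeasurableSpace Ω] {P : Measure Ω} {S : Ω → ℝ}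
    (hS : AEMeasurable S P) (h0 : 0 ≤ᵐ[P] S) : achievableRate P S = tailIntegral P S := by
  unfold achievableRate tailIntegral
  rw [lintegral_eq_lintegral_meas_lt P]
  · refine lintegral_congr fun u => measure_congr ?_
    filter_upwards [h0] with ω hω
    have hω0 : 0 ≤ S ω := hω
    refine propext ?_
    change u < Real.logb 2 (1 + S ω) ↔ (2 : ℝ) ^ u - 1 < S ω
    rw [Real.lt_logb_iff_rpow_lt one_lt_two (by linarith), sub_lt_iff_lt_add']
  · filter_upwards [h0] with ω hω
    have hω0 : 0 ≤ S ω := hω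
    exact Real.logb_nonneg one_lt_two (by linarith)
  · exact (Real.measurable_log.comp_aemeasurable (hS.const_add 1)).div_const _

lemma measurable_snr (α η : ℝ) : Measurable fun q : ℝ × ℝ≥0∞ => snr α η q.1 q.2 := by
  unfold snr
  exact Measurable.ite (measurable_snd (measurableSet_singleton ∞)) measurable_const (by fun_prop)

lemma snr_nonneg {α η h : ℝ} (hη : 0 ≤ η) (hh : 0 ≤ h) (d : ℝ≥0∞) : 0 ≤ snr α η h d := by
  unfold snr
  split_ifs
  · exact le_rfl
  · positivity

lemma snr_ofReal {α η h z : ℝ} (hz : 0 ≤ z) :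
    snr α η h (ENNReal.ofReal z) = η * h * z ^ (-α) := by
  simp [snr, hz]

lemma lt_snr_ofReal_iff {α η h z t : ℝ} (hη : 0 < η) (hz : 0 < z) :
    t < snr α η h (ENNReal.ofReal z) ↔ t * z ^ α / η < h := by
  have := Real.rpow_pos_of_pos hz α
  rw [snr_ofReal hz.le, Real.rpow_neg hz.le, div_lt_iff₀ hη, ← div_eq_mul_inv, lt_div_iff₀ this,
    mul_comm h η]

/-- A measure on the line charges the left end point of `[g z, ∞)` only for few `z`. -/
lemma ae_measure_Ioi_eq_measure_Ici (κ : Measure ℝ) [SFinite κ] {s : Set ℝ} (hs : MeasurableSet s)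
    {g : ℝ → ℝ} (hg : InjOn g s) :
    ∀ᵐ z ∂volume.restrict s, κ (Ioi (g z)) = κ (Ici (g z)) := by
  -- The atoms of `κ` are countable, and an injective `g` pulls them back to a countable, hence
  -- null, set.
  have hc : {t : ℝ | 0 < κ {a : ℝ | a = t}}.Countable :=
    Measure.countable_meas_level_set_pos (μ := κ) (g := fun a : ℝ => a) measurable_id
  have hc2 : {z | z ∈ s ∧ 0 < κ {g z}}.Countable := by
    refine MapsTo.countable_of_injOn (f := g) (t := {t : ℝ | 0 < κ {a : ℝ | a = t}})
      (fun z hz => hz.2) (hg.mono fun z hz => hz.1) hc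
  rw [ae_restrict_iff' hs]
  filter_upwards [hc2.ae_notMem volume] with z hz hzs
  have h0 : κ {g z} = 0 := by
    by_contra h
    exact hz ⟨hzs, pos_iff_ne_zero.2 h⟩
  exact measure_congr (Ioi_ae_eq_Ici' h0)

lemma ofReal_ccdf (κ : Measure ℝ) [IsFiniteMeasure κ] (x : ℝ) :
    ENNReal.ofReal (ccdf κ x) = κ (Ici x) := ENNReal.ofReal_toReal (measure_ne_top _ _)

/-- The rate of a link of deterministic length. -/
lemma tailIntegral_snr_const {Ω : Type*} [MeasurableSpace Ω] {P : Measure Ω} {κ : Measure ℝ}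
    [IsFiniteMeasure κ] {H : Ω → ℝ} (hH : HasLaw H κ P) {α η z : ℝ} (hη : 0 < η) (hz : 0 < z) :
    tailIntegral P (fun ω => snr α η (H ω) (ENNReal.ofReal z)) = rateG (ccdf κ) z α η := by
  have hc : 0 < z ^ α / η := div_pos (Real.rpow_pos_of_pos hz α) hη
  have hinj : Function.Injective fun u : ℝ => ((2 : ℝ) ^ u - 1) * z ^ α / η := fun u v h => by
    simp only [mul_div_assoc] at h
    exact two_rpow_sub_one_injective (mul_right_cancel₀ hc.ne' h)
  refine lintegral_congr_ae ?_
  filter_upwards [ae_measure_Ioi_eq_measure_Ici κ measurableSet_Ioi hinj.injOn] with u hu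
  rw [ofReal_ccdf, ← hu, ← hH.map_eq, Measure.map_apply_of_aemeasurable hH.aemeasurable
    measurableSet_Ioi]
  simp_rw [lt_snr_ofReal_iff hη hz]
  rfl

lemma ae_nonneg_of_hasLaw {Ω : Type*} [MeasurableSpace Ω] {P : Measure Ω} {κ : Measure ℝ}
    {H : Ω → ℝ} (hH : HasLaw H κ P) (hκ : κ (Iio 0) = 0) : ∀ᵐ ω ∂P, 0 ≤ H ω := by
  rw [← hH.map_eq, Measure.map_apply_of_aemeasurable hH.aemeasurable measurableSet_Iio] at hκ
  rw [ae_iff]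
  simp only [not_le]
  exact hκ

/-- The nearest distance depends measurably on the point process. -/
lemma indepFun_nearestDist {Ω T : Type*} [MeasurableSpace Ω] [MeasurableSpace T] {P : Measure Ω}
    {H : Ω → ℝ} {Ξ : Ω → T} {Ψ : Ω → Measure E3} (hΨ : IsPointProcess Ψ)
    (hind : IndepFun H (fun ω => (Ξ ω, Ψ ω)) P) (x : E3) {S : Set E3} (hS : MeasurableSet S) :
    IndepFun H (fun ω => nearestDist x S (Ψ ω)) P := by
  have h1 : IndepFun H Ψ P := hind.comp measurable_id measurable_snd
  have h2 : Measurable[MeasurableSpace.comap Ψ inferInstance]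
      fun ω => nearestDist x S (Ψ ω) :=
    @measurable_nearestDist Ω (MeasurableSpace.comap Ψ inferInstance) Ψ
      (comap_measurable Ψ) hΨ.counting x S hS
  rw [IndepFun_iff_Indep] at h1 ⊢
  exact indep_of_indep_of_le_right h1 h2.comap_le

/-- The coverage probability of the platform. -/
lemma prob_lt_snr_nearestDist {Ω : Type*} [MeasurableSpace Ω] {P : Measure Ω}
    [IsProbabilityMeasure P] {ra rs d lam mu α η t : ℝ} (hra : 0 < ra) (hrs : ra < rs)
    (hdr : rs - ra ≤ d) (hd : 0 ≤ capCos ra rs d) (hlam : 0 ≤ lam) (hmu : 0 ≤ mu)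
    {Ξ : Ω → Measure (ℝ × ℝ)} {Ψ : Ω → Measure E3}
    (hΞ : IsPoissonProcess P Ξ (orbitIntensity lam))
    (hΨ : IsCoxProcess P Ψ Ξ (satelliteIntensity rs mu))
    {κ : Measure ℝ} [IsProbabilityMeasure κ] {H : Ω → ℝ} (hH : HasLaw H κ P)
    (hind : IndepFun H (fun ω => (Ξ ω, Ψ ω)) P) (hη : 0 < η) (ht : 0 ≤ t) :
    P {ω | t < snr α η (H ω)
        (nearestDist (polePoint ra) (sphericalCap rs (polePoint ra) d) (Ψ ω))} =
      ∫⁻ z in Ioo (rs - ra) d, κ (Ioi (t * z ^ α / η)) * distDensity lam mu ra rs z := by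
  have hSm := measurableSet_sphericalCap rs (polePoint ra) d
  have hDm := measurable_nearestDist hΨ.1.1 hΨ.1.2 (polePoint ra) hSm
  have hjoint := (indepFun_iff_map_prod_eq_prod_map_map hH.aemeasurable hDm.aemeasurable).1
    (indepFun_nearestDist hΨ.isPointProcess hind (polePoint ra) hSm)
  have hset : MeasurableSet {q : ℝ × ℝ≥0∞ | t < snr α η q.1 q.2} :=
    measurableSet_lt measurable_const (measurable_snr α η)
  have hsec : Measurable fun x : ℝ≥0∞ => κ ((fun h => (h, x)) ⁻¹' {q | t < snr α η q.1 q.2}) :=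
    measurable_measure_prodMk_right hset
  have h1 : P {ω | t < snr α η (H ω)
      (nearestDist (polePoint ra) (sphericalCap rs (polePoint ra) d) (Ψ ω))} =
      P.map (fun ω => (H ω,
        nearestDist (polePoint ra) (sphericalCap rs (polePoint ra) d) (Ψ ω)))
        {q | t < snr α η q.1 q.2} := by
    rw [Measure.map_apply_of_aemeasurable (hH.aemeasurable.prodMk hDm.aemeasurable) hset]
    rfl
  -- Without a satellite the ratio is `0 ≤ t`, so the atom at `∞` contributes nothing.
  have htop : (fun h : ℝ => (h, (∞ : ℝ≥0∞))) ⁻¹' {q | t < snr α η q.1 q.2} = ∅ := by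
    ext h
    simp [snr, ht]
  rw [h1, hjoint, hH.map_eq, Measure.prod_apply_symm hset,
    map_nearestDist hra hrs hdr hd hlam hmu hΞ hΨ, lintegral_add_measure,
    lintegral_smul_measure, lintegral_dirac' _ hsec, htop, measure_empty, smul_zero, add_zero,
    lintegral_map hsec ENNReal.measurable_ofReal,
    lintegral_withDensity_eq_lintegral_mul _ (measurable_distDensity lam mu ra rs)
      (g := fun z => κ ((fun h => (h, ENNReal.ofReal z)) ⁻¹' {q | t < snr α η q.1 q.2}))
      (hsec.comp ENNReal.measurable_ofReal)]
  refine setLIntegral_congr_fun measurableSet_Ioo fun z hz => ?_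
  have hz0 : 0 < z := by linarith [hz.1]
  rw [Pi.mul_apply, mul_comm]
  congr 2
  ext h
  exact lt_snr_ofReal_iff hη hz0

/-- Fading tail, exponential factor and kernel separate, the last two forming the density of the
distance once `v` is integrated out. -/
lemma rateIntegrand_eq (F : ℝ → ℝ) (lam mu ra rs α η u z v : ℝ) :
    rateIntegrand F lam mu ra rs α η u z v =
      F (((2 : ℝ) ^ u - 1) * z ^ α / η) *
        (lam * Real.exp (-(lam * orbitHits mu ra rs z)) * hitsKernel mu ra rs z v) := by
  rw [rateIntegrand, ← orbitHits, sub_eq_add_neg (-(mu / π) * halfArc ra rs z v), Real.exp_add,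
    hitsKernel]
  ring

lemma lintegral_rateIntegrand {F : ℝ → ℝ} (hF : ∀ x, 0 ≤ F x) {lam : ℝ} (hlam : 0 ≤ lam)
    (mu ra rs α η u z : ℝ) :
    ∫⁻ v in Ioo 0 (zeta ra rs z), ENNReal.ofReal (rateIntegrand F lam mu ra rs α η u z v) =
      ENNReal.ofReal (F (((2 : ℝ) ^ u - 1) * z ^ α / η)) * distDensity lam mu ra rs z := by
  have hm : Measurable fun v => ENNReal.ofReal (hitsKernel mu ra rs z v) :=
    ((measurable_hitsKernel mu ra rs).comp measurable_prodMk_left).ennreal_ofReal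
  rw [distDensity, hitsDensity, ← mul_assoc, ← lintegral_const_mul _ hm]
  refine lintegral_congr fun v => ?_
  rw [rateIntegrand_eq, ENNReal.ofReal_mul (hF _), mul_assoc (ENNReal.ofReal _),
    ENNReal.ofReal_mul (p := lam * Real.exp (-(lam * orbitHits mu ra rs z))) (by positivity)]

lemma ccdf_nonneg (κ : Measure ℝ) (x : ℝ) : 0 ≤ ccdf κ x := ENNReal.toReal_nonneg

lemma rateA_eq {F : ℝ → ℝ} (hF : ∀ x, 0 ≤ F x) {lam : ℝ} (hlam : 0 ≤ lam)
    (mu re ra rs α η : ℝ) :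
    rateA F lam mu re ra rs α η =
      ∫⁻ u in Ioi (0 : ℝ), ∫⁻ z in Ioo (rs - ra) (capDist re ra rs),
        ENNReal.ofReal (F (((2 : ℝ) ^ u - 1) * z ^ α / η)) * distDensity lam mu ra rs z := by
  simp_rw [rateA, lintegral_rateIntegrand hF hlam]

lemma injOn_mul_rpow_div {α η t : ℝ} (hα : α ≠ 0) (hη : η ≠ 0) (ht : t ≠ 0) :
    InjOn (fun z : ℝ => t * z ^ α / η) (Ioi 0) := fun x hx y hy h => by
  have h1 : t * x ^ α = t * y ^ α := by
    have := congrArg (· * η) h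
    simpa [hη] using this
  exact (Real.rpow_left_inj (le_of_lt hx) (le_of_lt hy) hα).1 (mul_left_cancel₀ ht h1)

/-- The rate of the platform. -/
theorem tailIntegral_snrPlatform {Ω : Type*} [MeasurableSpace Ω] {P : Measure Ω}
    [IsProbabilityMeasure P] {re ra rs lam mu α η : ℝ} (hre : 0 < re) (hea : re < ra)
    (has : ra < rs) (hcap : phiBar re ra rs ≤ π / 2) (hlam : 0 ≤ lam) (hmu : 0 ≤ mu)
    {Ξ : Ω → Measure (ℝ × ℝ)} {Ψ : Ω → Measure E3}
    (hΞ : IsPoissonProcess P Ξ (orbitIntensity lam))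
    (hΨ : IsCoxProcess P Ψ Ξ (satelliteIntensity rs mu))
    {κ : Measure ℝ} [IsProbabilityMeasure κ] {H : Ω → ℝ} (hH : HasLaw H κ P)
    (hind : IndepFun H (fun ω => (Ξ ω, Ψ ω)) P) (hα : α ≠ 0) (hη : 0 < η) :
    tailIntegral P (snrPlatform re ra rs α η Ψ H) = rateA (ccdf κ) lam mu re ra rs α η := by
  rw [rateA_eq (ccdf_nonneg κ) hlam]
  refine setLIntegral_congr_fun measurableSet_Ioi fun u hu => ?_
  have ht := two_rpow_sub_one_pos hu
  have hsub : Ioo (rs - ra) (capDist re ra rs) ⊆ Ioi 0 := fun z hz => by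
    have : rs - ra < z := hz.1
    exact mem_Ioi.2 (by linarith)
  refine (prob_lt_snr_nearestDist (hre.trans hea) has (sub_lt_capDist hre hea has hcap).le
    (capCos_capDist_nonneg hre hea has hcap) hlam hmu hΞ hΨ hH hind hη ht.le).trans ?_
  refine lintegral_congr_ae ?_
  filter_upwards [ae_measure_Ioi_eq_measure_Ici κ measurableSet_Ioo
    ((injOn_mul_rpow_div hα hη.ne' ht.ne').mono hsub)] with z hz
  rw [hz, ofReal_ccdf]

lemma ccdf_antitone (κ : Measure ℝ) [IsFiniteMeasure κ] : Antitone (ccdf κ) := fun _ _ h =>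
  ENNReal.toReal_mono (measure_ne_top _ _) (measure_mono (Ici_subset_Ici.2 h))

/-- The rate of the platform is at most that of a link to a satellite right above it. -/
lemma rateA_le_rateG {re ra rs lam mu α η : ℝ} (hre : 0 < re) (hea : re < ra)
    (has : ra < rs) (hcap : phiBar re ra rs ≤ π / 2) (hlam : 0 ≤ lam) (hmu : 0 ≤ mu)
    (κ : Measure ℝ) [IsFiniteMeasure κ] (hα : 0 ≤ α) (hη : 0 < η) :
    rateA (ccdf κ) lam mu re ra rs α η ≤ rateG (ccdf κ) (rs - ra) α η := by
  rw [rateA_eq (ccdf_nonneg κ) hlam]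
  refine setLIntegral_mono' measurableSet_Ioi fun u hu => ?_
  have ht := two_rpow_sub_one_pos hu
  have hmass : ∫⁻ z in Ioo (rs - ra) (capDist re ra rs), distDensity lam mu ra rs z ≤ 1 := by
    rw [lintegral_distDensity hlam hmu (hre.trans hea) has (sub_lt_capDist hre hea has hcap).le
      (capCos_capDist_nonneg hre hea has hcap), ENNReal.ofReal_le_one]
    linarith [Real.exp_pos (-(lam * orbitHits mu ra rs (capDist re ra rs)))]
  calc _ ≤ ∫⁻ z in Ioo (rs - ra) (capDist re ra rs),
        ENNReal.ofReal (ccdf κ (((2 : ℝ) ^ u - 1) * (rs - ra) ^ α / η)) *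
          distDensity lam mu ra rs z := by
        refine setLIntegral_mono' measurableSet_Ioo fun z hz => ?_
        gcongr
        refine ccdf_antitone κ ?_
        have h1 : rs - ra ≤ z := hz.1.le
        have h2 : 0 ≤ rs - ra := by linarith
        gcongr
    _ = ENNReal.ofReal (ccdf κ (((2 : ℝ) ^ u - 1) * (rs - ra) ^ α / η)) *
          ∫⁻ z in Ioo (rs - ra) (capDist re ra rs), distDensity lam mu ra rs z :=
        lintegral_const_mul _ (measurable_distDensity lam mu ra rs)
    _ ≤ _ := mul_le_of_le_one_right' hmass

/-- The rate of a link of deterministic length is finite if the fading has finite mean. -/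
lemma rateG_lt_top {κ : Measure ℝ} [IsProbabilityMeasure κ] (hκ : κ (Iio 0) = 0)
    (hmean : ∫⁻ x, ENNReal.ofReal x ∂κ < ∞) {α η z : ℝ} (hη : 0 < η) (hz : 0 < z) :
    rateG (ccdf κ) z α η < ∞ := by
  -- The identity on `(ℝ, κ)` serves as fading variable, turning the integral back into an expected
  -- logarithm.
  have hid : HasLaw (fun x : ℝ => x) κ κ := ⟨aemeasurable_id, Measure.map_id⟩
  have h0 : ∀ᵐ x ∂κ, (0 : ℝ) ≤ x := ae_nonneg_of_hasLaw hid hκ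
  have hm : Measurable fun x : ℝ => snr α η x (ENNReal.ofReal z) :=
    (measurable_snr α η).comp measurable_prodMk_right
  rw [← tailIntegral_snr_const hid hη hz, ← achievableRate_eq_tailIntegral hm.aemeasurable
    (h0.mono fun x hx => snr_nonneg hη.le hx _)]
  have hlog : 0 < Real.log 2 := Real.log_pos one_lt_two
  have hzα : 0 < z ^ (-α) := Real.rpow_pos_of_pos hz _
  refine lt_of_le_of_lt (lintegral_mono_ae (g := fun x =>
    ENNReal.ofReal (η * z ^ (-α) / Real.log 2) * ENNReal.ofReal x) (h0.mono fun x hx => ?_)) ?_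
  · simp only [snr_ofReal hz.le]
    rw [← ENNReal.ofReal_mul (by positivity), Real.logb]
    refine ENNReal.ofReal_le_ofReal ?_
    rw [div_mul_eq_mul_div]
    gcongr
    refine (Real.log_le_sub_one_of_pos (by positivity)).trans (le_of_eq (by ring))
  · rw [lintegral_const_mul _ ENNReal.measurable_ofReal]
    exact ENNReal.mul_lt_top ENNReal.ofReal_lt_top hmean

/-! ### Nakagami fading -/

/-- Multiplying the gamma density of shape `a` by `x` gives `a / r` times the density of shape `a +
1`. -/
lemma lintegral_gammaMeasure_lt_top {a r : ℝ} (ha : 0 < a) (hr : 0 < r) :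
    ∫⁻ x, ENNReal.ofReal x ∂(gammaMeasure a r) < ∞ := by
  have hm : ∀ b, Measurable (gammaPDF b r) := fun b =>
    (measurable_gammaPDFReal b r).ennreal_ofReal
  have h : ∀ x, gammaPDF a r x * ENNReal.ofReal x =
      ENNReal.ofReal (a / r) * gammaPDF (a + 1) r x := by
    intro x
    rcases lt_or_ge x 0 with hx | hx
    · simp [gammaPDF_of_neg hx]
    · have hg := Real.Gamma_pos_of_pos ha
      rw [gammaPDF_of_nonneg hx, gammaPDF_of_nonneg hx, ← ENNReal.ofReal_mul (by positivity),
        ← ENNReal.ofReal_mul (by positivity), Real.Gamma_add_one ha.ne', Real.rpow_add_one hr.ne']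
      congr 1
      have hxa : x ^ (a + 1 - 1) = x ^ (a - 1) * x := by
        rcases hx.eq_or_lt with rfl | hx
        · simp [ha.ne']
        · rw [← Real.rpow_add_one hx.ne']; ring_nf
      rw [hxa]
      field_simp
  rw [gammaMeasure, lintegral_withDensity_eq_lintegral_mul _ (hm a) ENNReal.measurable_ofReal]
  simp only [Pi.mul_apply]
  simp_rw [h]
  rw [lintegral_const_mul _ (hm _), lintegral_gammaPDF_eq_one (by linarith) hr, mul_one]
  exact ENNReal.ofReal_lt_top

/-- The law has no atoms, so this is one minus the distribution function, rescaled by `s = r t`. -/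
lemma ccdf_gammaMeasure {a r x : ℝ} (ha : 0 < a) (hr : 0 < r) (hx : 0 ≤ x) :
    ccdf (gammaMeasure a r) x = 1 - lowerGamma a (r * x) / Real.Gamma a := by
  have hprob := isProbabilityMeasure_gammaMeasure ha hr
  have hg := Real.Gamma_pos_of_pos ha
  have hIio : gammaMeasure a r (Iio x) = gammaMeasure a r (Iic x) :=
    measure_congr ((withDensity_absolutelyContinuous _ _).ae_eq Iio_ae_eq_Iic)
  have h1 : ccdf (gammaMeasure a r) x = 1 - cdf (gammaMeasure a r) x := by
    rw [ccdf, ← measureReal_def, cdf_eq_real, ← compl_Iio,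
      probReal_compl_eq_one_sub measurableSet_Iio, measureReal_def, hIio, measureReal_def]
  have h2 : ∫ t in Iic x, gammaPDFReal a r t = ∫ t in Icc 0 x, gammaPDFReal a r t := by
    refine setIntegral_eq_of_subset_of_forall_sdiff_eq_zero measurableSet_Iic
      Icc_subset_Iic_self fun t ht => ?_
    have : t < 0 := not_le.1 fun h => ht.2 ⟨h, ht.1⟩
    simp [gammaPDFReal, not_le.2 this]
  have h3 : ∫ t in (0 : ℝ)..x, gammaPDFReal a r t = lowerGamma a (r * x) / Real.Gamma a := by
    have hsub := intervalIntegral.smul_integral_comp_mul_left (a := 0) (b := x)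
      (fun s => s ^ (a - 1) * Real.exp (-s)) r
    rw [mul_zero] at hsub
    rw [lowerGamma, ← hsub, smul_eq_mul, mul_div_right_comm, ← intervalIntegral.integral_const_mul]
    refine intervalIntegral.integral_congr fun t ht => ?_
    rw [uIcc_of_le hx] at ht
    have hra : r ^ a = r * r ^ (a - 1) := by
      rw [mul_comm, ← Real.rpow_add_one hr.ne', sub_add_cancel]
    simp only [gammaPDFReal, if_pos ht.1]
    rw [Real.mul_rpow hr.le ht.1, hra]
    ring
  rw [h1, cdf_gammaMeasure_eq_integral ha hr, h2, integral_Icc_eq_integral_Ioc,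
    ← intervalIntegral.integral_of_le hx, h3]

lemma edist_polePoint {re ra : ℝ} (h : re < ra) :
    edist (polePoint ra) (polePoint re) = ENNReal.ofReal (ra - re) := by
  rw [edist_dist, EuclideanSpace.dist_eq, Fin.sum_univ_three]
  simp [polePoint, Real.sqrt_sq_eq_abs, Real.dist_eq, abs_of_pos (sub_pos.2 h)]

end SatNet

end

/-! ### The end-to-end throughput -/

theorem theorem5 {Ω : Type*} [MeasurableSpace Ω] (P : Measure Ω) [IsProbabilityMeasure P]
    -- radii of the Earth, of the platforms and of the orbits
    (re ra rs : ℝ) (hre : 0 < re) (hea : re < ra) (has : ra < rs)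
    (hφ : SatNet.phiBar re ra rs ≤ π / 2)
    -- mean number of orbits, mean number of satellites per orbit, path loss exponent
    (lam mu α : ℝ) (hlam : 0 < lam) (hmu : 0 < mu) (hα : 2 ≤ α)
    -- powers, antenna gains, noise density, bandwidths
    (ps pa gs ga gg No Bs Ba : ℝ) (hps : 0 < ps) (hpa : 0 < pa) (hgs : 0 < gs) (hga : 0 < ga)
    (hgg : 0 < gg) (hNo : 0 < No) (hBs : 0 < Bs) (hBa : 0 < Ba)
    -- orbit process and satellite process
    (Ξ : Ω → Measure (ℝ × ℝ)) (Ψ : Ω → Measure SatNet.E3)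
    (hΞ : SatNet.IsPoissonProcess P Ξ (SatNet.orbitIntensity lam))
    (hΨ : SatNet.IsCoxProcess P Ψ Ξ (SatNet.satelliteIntensity rs mu))
    -- law of the fading, and fading variables of the two links
    (κ : Measure ℝ) (hκ : κ (Iio 0) = 0) (HA HG : Ω → ℝ)
    (hHA : HasLaw HA κ P) (hHG : HasLaw HG κ P)
    (hind : IndepFun HA (fun ω => (Ξ ω, Ψ ω)) P) :
    let ηs := SatNet.linkSnr ps ga gs No Bs
    let ηg := SatNet.linkSnr pa ga gg No Ba
    let SA := SatNet.snrPlatform re ra rs α ηs Ψ HA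
    let SG := SatNet.snrGateway re ra α ηg HG
    let RA := SatNet.rateA (SatNet.ccdf κ) lam mu re ra rs α ηs
    let RG := SatNet.rateG (SatNet.ccdf κ) (ra - re) α ηg
    SatNet.throughput P SA SG = min RA RG ∧
    (AEMeasurable SA P ∧ SatNet.achievableRate P SA = SatNet.tailIntegral P SA ∧
      SatNet.tailIntegral P SA = RA) ∧
    (AEMeasurable SG P ∧ SatNet.achievableRate P SG = SatNet.tailIntegral P SG ∧
      SatNet.tailIntegral P SG = RG) ∧
    -- Nakagami fading with parameters `m` and `w`
    (∀ m w : ℝ, 0 < m → 0 < w → κ = gammaMeasure m (w / m) →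
      (∀ x, 0 ≤ x → SatNet.ccdf κ x = 1 - SatNet.lowerGamma m (w * x / m) / Real.Gamma m) ∧
      RA < ∞ ∧ RG < ∞) := by
  intro ηs ηg SA SG RA RG
  have hra : 0 < ra := hre.trans hea
  have hηs : 0 < ηs := div_pos (by positivity) (by positivity)
  have hηg : 0 < ηg := div_pos (by positivity) (by positivity)
  have hκP : IsProbabilityMeasure κ := by
    rw [← hHA.map_eq]; exact Measure.isProbabilityMeasure_map hHA.aemeasurable
  have hDm := SatNet.measurable_nearestDist hΨ.1.1 hΨ.1.2 (SatNet.polePoint ra)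
    (SatNet.measurableSet_sphericalCap rs (SatNet.polePoint ra) (SatNet.capDist re ra rs))
  have hSA : AEMeasurable SA P :=
    (SatNet.measurable_snr α ηs).comp_aemeasurable (hHA.aemeasurable.prodMk hDm.aemeasurable)
  have hSG : AEMeasurable SG P :=
    (SatNet.measurable_snr α ηg).comp_aemeasurable (hHG.aemeasurable.prodMk aemeasurable_const)
  have hA1 : SatNet.achievableRate P SA = SatNet.tailIntegral P SA :=
    SatNet.achievableRate_eq_tailIntegral hSA
      ((SatNet.ae_nonneg_of_hasLaw hHA hκ).mono fun ω hω => SatNet.snr_nonneg hηs.le hω _)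
  have hG1 : SatNet.achievableRate P SG = SatNet.tailIntegral P SG :=
    SatNet.achievableRate_eq_tailIntegral hSG
      ((SatNet.ae_nonneg_of_hasLaw hHG hκ).mono fun ω hω => SatNet.snr_nonneg hηg.le hω _)
  have hA2 : SatNet.tailIntegral P SA = RA :=
    SatNet.tailIntegral_snrPlatform hre hea has hφ hlam.le hmu.le hΞ hΨ hHA hind (by linarith) hηs
  have hG2 : SatNet.tailIntegral P SG = RG := by
    have h : SG = fun ω => SatNet.snr α ηg (HG ω) (ENNReal.ofReal (ra - re)) := by
      funext ω
      rw [← SatNet.edist_polePoint hea]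
      rfl
    rw [h]
    exact SatNet.tailIntegral_snr_const hHG hηg (sub_pos.2 hea)
  refine ⟨?_, ⟨hSA, hA1, hA2⟩, ⟨hSG, hG1, hG2⟩, fun m w hm hw hmw => ⟨fun x hx => ?_, ?_, ?_⟩⟩
  · rw [SatNet.throughput, hA1, hA2, hG1, hG2]
  · rw [hmw, SatNet.ccdf_gammaMeasure hm (div_pos hw hm) hx, div_mul_eq_mul_div]
  -- A satellite is never nearer than `rs - ra`, so a link of that fixed length dominates.
  · refine (SatNet.rateA_le_rateG hre hea has hφ hlam.le hmu.le κ (by linarith) hηs).trans_lt ?_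
    refine SatNet.rateG_lt_top hκ ?_ hηs (sub_pos.2 has)
    rw [hmw]
    exact SatNet.lintegral_gammaMeasure_lt_top hm (div_pos hw hm)
  · refine SatNet.rateG_lt_top hκ ?_ hηg (sub_pos.2 hea)
    rw [hmw]
    exact SatNet.lintegral_gammaMeasure_lt_top hm (div_pos hw hm)
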